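/- Let $U\subseteq\mathbb{R}^4$ be a connected open set with coordinates $(\tau,\phi,p,q)$, and let $P=P(p)$ and $Q=Q(q)$ be smooth real functions, defined on the projections of $U$ to the $p$-axis and the $q$-axis, such that $P>0$, $Q<0$, $p\neq q$ and $1-p^2q^2>0$ on $U$. Consider on $U$ the Plebański–Demiański Riemannian metric \[ g = \frac{1}{(p-q)^2}\left[ -Q\,\frac{(d\tau-p^2 d\phi)^2}{1-p^2q^2}+P\,\frac{(d\phi - q^2 d\tau)^2}{1-p^2q^2}+(1-p^2q^2)\left(\frac{dp^2}{P}-\frac{dq^2}{Q} \right) \right]. \] Let $\lambda\in\mathbb{R}$. The metric $g$ is said to satisfy the cosmological Einstein–Maxwell equations with cosmological constant $\lambda$ if there is a smooth $2$-form $F$ on $U$ such that \[ R_{ab}-\frac{R}{2}g_{ab} +\lambda g_{ab} = 2F_{ac}F_{b}{}^{c} - \frac{1}{2}g_{ab}F_{cd}F^{cd}, \qquad \nabla^{a}F_{ab} = 0, \qquad \nabla_{[a}F_{bc]}=0, \] where $\nabla$, $R_{ab}$ and $R$ are the Levi-Civita connection, the Ricci tensor and the scalar curvature of $g$ (with the sign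 for which round spheres have $R>0$). Then $g$ satisfies the cosmological Einstein–Maxwell equations with cosmological constant $\lambda$ if and only if there are real constants $a_0,a_1,a_2,a_3,a_4$ such that, on $U$, \[ P = a_{0}+a_{1}p+a_{2}p^{2}+a_{3}p^{3}+a_{4}p^{4}, \qquad Q = \left(a_{0}+\tfrac{\lambda}{3}\right)+a_{1}q+a_{2}q^{2}+a_{3}q^{3}+\left(a_{4}-\tfrac{\lambda}{3}\right)q^{4}. \] -/

import Mathlib

open scoped ContDiff

noncomputable section

/-! Riemannian geometry of a four-dimensional coordinate domain, in index notation.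
Points are coordinate vectors `x : Fin 4 → ℝ`; tensor fields are given by their components
in the coordinate basis. Only values on an open set of interest matter. -/

/-- A `2`-index covariant tensor field in coordinates: `T x a b` is `T_{ab}(x)`. -/
abbrev Tensor2 : Type := (Fin 4 → ℝ) → Matrix (Fin 4) (Fin 4) ℝ

/-- The coordinate derivative `∂_i f` at `x`. -/
def pderiv4 (i : Fin 4) (f : (Fin 4 → ℝ) → ℝ) (x : Fin 4 → ℝ) : ℝ :=
  fderiv ℝ f x (Pi.single i 1)

/-- The Christoffel symbols `Γ^k_{ij}` of the Levi-Civita connection of `g`;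
`(g x)⁻¹ k l` is `g^{kl}`. -/
def christoffel (g : Tensor2) (k i j : Fin 4) (x : Fin 4 → ℝ) : ℝ :=
  (1 / 2) * ∑ l, (g x)⁻¹ k l *
    (pderiv4 i (fun y => g y j l) x + pderiv4 j (fun y => g y i l) x
      - pderiv4 l (fun y => g y i j) x)

/-- The Riemann tensor
`R^k_{lij} = ∂_i Γ^k_{jl} - ∂_j Γ^k_{il} + Γ^k_{im} Γ^m_{jl} - Γ^k_{jm} Γ^m_{il}`. -/
def riemannTensor (g : Tensor2) (k l i j : Fin 4) (x : Fin 4 → ℝ) : ℝ :=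
  pderiv4 i (christoffel g k j l) x - pderiv4 j (christoffel g k i l) x
    + ∑ m, (christoffel g k i m x * christoffel g m j l x
      - christoffel g k j m x * christoffel g m i l x)

/-- The Ricci tensor `R_{ab} = R^k_{akb}` (positive on round spheres). -/
def ricciTensor (g : Tensor2) (a b : Fin 4) (x : Fin 4 → ℝ) : ℝ :=
  ∑ k, riemannTensor g k a k b x

/-- The scalar curvature `R = g^{ab} R_{ab}`. -/
def scalarCurv (g : Tensor2) (x : Fin 4 → ℝ) : ℝ :=
  ∑ a, ∑ b, (g x)⁻¹ a b * ricciTensor g a b x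

/-- The covariant derivative `∇_a F_{bc}` for the Levi-Civita connection of `g`. -/
def covDeriv2 (g F : Tensor2) (a b c : Fin 4) (x : Fin 4 → ℝ) : ℝ :=
  pderiv4 a (fun y => F y b c) x
    - ∑ d, christoffel g d a b x * F x d c - ∑ d, christoffel g d a c x * F x b d

/-- `F` is a smooth differential `2`-form on `U`. -/
def IsSmoothTwoForm (F : Tensor2) (U : Set (Fin 4 → ℝ)) : Prop :=
  (∀ a b, ContDiffOn ℝ ∞ (fun x => F x a b) U) ∧ ∀ x ∈ U, ∀ a b, F x b a = - F x a b

/-- The contraction `F_{ac} F_b{}^c`. -/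
def maxwellSquare (g F : Tensor2) (a b : Fin 4) (x : Fin 4 → ℝ) : ℝ :=
  ∑ c, ∑ d, (g x)⁻¹ c d * F x a c * F x b d

/-- The full contraction `F_{cd} F^{cd}`. -/
def maxwellNormSq (g F : Tensor2) (x : Fin 4 → ℝ) : ℝ :=
  ∑ a, ∑ b, (g x)⁻¹ a b * maxwellSquare g F a b x

/-- The pair `(g, F)` solves the Einstein-Maxwell equations with cosmological constant `lam`
on `U`: `R_{ab} - (R/2) g_{ab} + lam g_{ab} = 2 F_{ac} F_b{}^c - (1/2) g_{ab} F_{cd} F^{cd}`,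
`∇^a F_{ab} = 0` and `∇_{[a} F_{bc]} = 0`. For the skew tensor `F` the
last expression is a third of the cyclic sum. -/
def SolvesEinsteinMaxwell (g F : Tensor2) (lam : ℝ) (U : Set (Fin 4 → ℝ)) : Prop :=
  (∀ x ∈ U, ∀ a b,
    ricciTensor g a b x - scalarCurv g x / 2 * g x a b + lam * g x a b
      = 2 * maxwellSquare g F a b x - (1 / 2) * g x a b * maxwellNormSq g F x) ∧
  (∀ x ∈ U, ∀ b, ∑ a, ∑ c, (g x)⁻¹ a c * covDeriv2 g F c a b x = 0) ∧
  (∀ x ∈ U, ∀ a b c,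
    (covDeriv2 g F a b c x + covDeriv2 g F b c a x + covDeriv2 g F c a b x) / 3 = 0)

/-- The metric `g` satisfies the cosmological Einstein-Maxwell equations on `U`: it does so
together with some Maxwell field. -/
def SatisfiesCosmologicalEinsteinMaxwell (g : Tensor2) (lam : ℝ) (U : Set (Fin 4 → ℝ)) : Prop :=
  ∃ F : Tensor2, IsSmoothTwoForm F U ∧ SolvesEinsteinMaxwell g F lam U

/-- The Plebański-Demiański metric with structure functions `P`, `Q`, in coordinates
`x = (τ, φ, p, q)`. The row vectors below are the components of
`dτ - p² dφ`, `dφ - q² dτ`, `dp` and `dq`; `vecMulVec θ θ` is `θ ⊗ θ`. -/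
def plebanskiDemianski (P Q : ℝ → ℝ) : Tensor2 := fun x =>
  let p := x 2
  let q := x 3
  let θ : Fin 4 → ℝ := ![1, -p ^ 2, 0, 0]
  let η : Fin 4 → ℝ := ![-q ^ 2, 1, 0, 0]
  let dp : Fin 4 → ℝ := ![0, 0, 1, 0]
  let dq : Fin 4 → ℝ := ![0, 0, 0, 1]
  (1 / (p - q) ^ 2) •
    (-(Q q / (1 - p ^ 2 * q ^ 2)) • Matrix.vecMulVec θ θ
      + (P p / (1 - p ^ 2 * q ^ 2)) • Matrix.vecMulVec η η
      + (1 - p ^ 2 * q ^ 2) •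
        ((1 / P p) • Matrix.vecMulVec dp dp - (1 / Q q) • Matrix.vecMulVec dq dq))

end

/-! Everything depends on `p` and `q` only, and the Ricci tensor has two double eigenvalues,
`pdRicciQ` and `pdRicciP`, on the planes spanned by θ, dq and by η, dp (`ricciTensor_eq`).

Necessity uses only the trace of the Einstein equation. The Maxwell stress tensor is trace-free in
dimension four, so R = 4λ. Multiplied by 1 - p²q², this is a linear equation in P, P', P'', Q, Q',
Q'' with polynomial coefficients (`pdRicciQ_add_pdRicciP`). Three differentiations in `p` at fixed
`q` remove all of Q and leave (p - q)² P⁽⁵⁾ = 0, so P is a quartic. The equation, as a function of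
`p`, is then a polynomial of degree at most two; extrapolating it to p = q gives Q(q) = P(q) +
(λ/3)(1 - q⁴), where P(q) means the value of the quartic (`exists_quartic_of_scalarCurv_equation`).

Sufficiency needs a Maxwell field. The forms θ ∧ dq ± η ∧ dp have opposite duality, and rescaled by
(1 ± pq)⁻² they are closed and coclosed. For the combination with coefficients α and β, the stress
tensor is bilinear in the two parts, with eigenvalues ±4αβ (p - q)⁴ / (1 - p²q²)². For quartic P and
Q the trace-free Ricci tensor has eigenvalues ±(a₄ - a₀ - λ/3)(p - q)⁴ / (1 - p²q²)², so it suffices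
that 4αβ = a₄ - a₀ - λ/3. Only the product counts: α = 1 works whatever the sign of the right-hand
side (`solvesEinsteinMaxwell_of_quartic`). -/

open scoped ContDiff

noncomputable section

/-! ### Calculus of functions of `p` and `q` -/

/-- `f` is differentiable at `x` with gradient `(0, 0, a, b)`. -/
def HasGrad (f : (Fin 4 → ℝ) → ℝ) (a b : ℝ) (x : Fin 4 → ℝ) : Prop :=
  HasFDerivAt f (a • ContinuousLinearMap.proj (R := ℝ) (φ := fun _ : Fin 4 => ℝ) 2
    + b • ContinuousLinearMap.proj (R := ℝ) (φ := fun _ : Fin 4 => ℝ) 3) x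

namespace HasGrad

variable {f g : (Fin 4 → ℝ) → ℝ} {a b c d : ℝ} {x : Fin 4 → ℝ}

theorem pderiv_eq (h : HasGrad f a b x) (i : Fin 4) :
    pderiv4 i f x = (![0, 0, a, b] : Fin 4 → ℝ) i := by
  unfold pderiv4
  rw [HasFDerivAt.fderiv h]
  fin_cases i <;> simp

theorem congr_of_eventuallyEq (h : HasGrad f a b x) (hfg : g =ᶠ[nhds x] f) : HasGrad g a b x :=
  HasFDerivAt.congr_of_eventuallyEq h hfg

theorem congr_grad (h : HasGrad f a b x) (hac : a = c) (hbd : b = d) : HasGrad f c d x := by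
  subst hac hbd; exact h

theorem const (k : ℝ) : HasGrad (fun _ => k) 0 0 x := by
  simpa [HasGrad] using hasFDerivAt_const k x

theorem coord_two : HasGrad (fun y => y 2) 1 0 x :=
  (ContinuousLinearMap.proj (R := ℝ) (φ := fun _ : Fin 4 => ℝ) 2).hasFDerivAt.congr_fderiv
    (by simp)

theorem coord_three : HasGrad (fun y => y 3) 0 1 x :=
  (ContinuousLinearMap.proj (R := ℝ) (φ := fun _ : Fin 4 => ℝ) 3).hasFDerivAt.congr_fderiv
    (by simp)

theorem add (hf : HasGrad f a b x) (hg : HasGrad g c d x) :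
    HasGrad (fun y => f y + g y) (a + c) (b + d) x :=
  (HasFDerivAt.fun_add hf hg).congr_fderiv (by ext; simp; ring)

theorem neg (hf : HasGrad f a b x) : HasGrad (fun y => -f y) (-a) (-b) x :=
  (HasFDerivAt.fun_neg hf).congr_fderiv (by ext; simp; ring)

theorem sub (hf : HasGrad f a b x) (hg : HasGrad g c d x) :
    HasGrad (fun y => f y - g y) (a - c) (b - d) x :=
  (HasFDerivAt.fun_sub hf hg).congr_fderiv (by ext; simp; ring)

theorem mul (hf : HasGrad f a b x) (hg : HasGrad g c d x) :
    HasGrad (fun y => f y * g y) (a * g x + f x * c) (b * g x + f x * d) x :=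
  (HasFDerivAt.fun_mul hf hg).congr_fderiv (by ext; simp; ring)

theorem comp {φ : ℝ → ℝ} {φ' : ℝ} (hf : HasGrad f a b x) (hφ : HasDerivAt φ φ' (f x)) :
    HasGrad (fun y => φ (f y)) (φ' * a) (φ' * b) x :=
  (hφ.comp_hasFDerivAt x hf).congr_fderiv (by ext; simp; ring)

theorem sq (hf : HasGrad f a b x) : HasGrad (fun y => f y ^ 2) (2 * f x * a) (2 * f x * b) x := by
  simpa using hf.comp (hasDerivAt_pow 2 (f x))

theorem inv (hf : HasGrad f a b x) (h0 : f x ≠ 0) :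
    HasGrad (fun y => (f y)⁻¹) (-a / f x ^ 2) (-b / f x ^ 2) x :=
  (hf.comp (hasDerivAt_inv h0)).congr_grad (by ring) (by ring)

end HasGrad

/-! ### The metric, its inverse and its Christoffel symbols -/

/-- Pointwise regularity of the structure functions: `P₁, P₂` are the first two derivatives of
`P` at `x 2`, `Q₁, Q₂` those of `Q` at `x 3`, and the metric is nondegenerate at `x`. -/
structure PDRegularAt (P P₁ P₂ Q Q₁ Q₂ : ℝ → ℝ) (x : Fin 4 → ℝ) : Prop where
  hP : HasDerivAt P (P₁ (x 2)) (x 2)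
  hP₁ : HasDerivAt P₁ (P₂ (x 2)) (x 2)
  hQ : HasDerivAt Q (Q₁ (x 3)) (x 3)
  hQ₁ : HasDerivAt Q₁ (Q₂ (x 3)) (x 3)
  P_ne : P (x 2) ≠ 0
  Q_ne : Q (x 3) ≠ 0
  sub_ne : x 2 - x 3 ≠ 0
  W_ne : 1 - x 2 ^ 2 * x 3 ^ 2 ≠ 0

/-- The reciprocal `1 / (p - q)`. -/
def pdU (x : Fin 4 → ℝ) : ℝ := (x 2 - x 3)⁻¹

/-- The reciprocal `1 / (1 - p² q²)`. -/
def pdW (x : Fin 4 → ℝ) : ℝ := (1 - x 2 ^ 2 * x 3 ^ 2)⁻¹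

theorem plebanskiDemianski_eq (P Q : ℝ → ℝ) (x : Fin 4 → ℝ) :
    plebanskiDemianski P Q x =
      !![pdU x ^ 2 * pdW x * (P (x 2) * (x 3 ^ 2) ^ 2 - Q (x 3)),
         pdU x ^ 2 * pdW x * (Q (x 3) * x 2 ^ 2 - P (x 2) * x 3 ^ 2), 0, 0;
         pdU x ^ 2 * pdW x * (Q (x 3) * x 2 ^ 2 - P (x 2) * x 3 ^ 2),
         pdU x ^ 2 * pdW x * (P (x 2) - Q (x 3) * (x 2 ^ 2) ^ 2), 0, 0;
         0, 0, pdU x ^ 2 * (1 - x 2 ^ 2 * x 3 ^ 2) * (P (x 2))⁻¹, 0;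
         0, 0, 0, -(pdU x ^ 2 * (1 - x 2 ^ 2 * x 3 ^ 2) * (Q (x 3))⁻¹)] := by
  ext i j
  fin_cases i <;> fin_cases j <;>
    simp [plebanskiDemianski, pdU, pdW] <;> ring

/-- The inverse of the Plebański-Demiański metric. -/
def pdInverse (P Q : ℝ → ℝ) (x : Fin 4 → ℝ) : Matrix (Fin 4) (Fin 4) ℝ :=
  (x 2 - x 3) ^ 2 •
    !![pdW x * (x 2 ^ 4 * (P (x 2))⁻¹ - (Q (x 3))⁻¹),
       pdW x * (x 2 ^ 2 * (P (x 2))⁻¹ - x 3 ^ 2 * (Q (x 3))⁻¹), 0, 0;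
       pdW x * (x 2 ^ 2 * (P (x 2))⁻¹ - x 3 ^ 2 * (Q (x 3))⁻¹),
       pdW x * ((P (x 2))⁻¹ - x 3 ^ 4 * (Q (x 3))⁻¹), 0, 0;
       0, 0, pdW x * P (x 2), 0;
       0, 0, 0, -(pdW x * Q (x 3))]

section

variable {P P₁ P₂ Q Q₁ Q₂ : ℝ → ℝ} {x : Fin 4 → ℝ}

theorem plebanskiDemianski_inv (hP : P (x 2) ≠ 0) (hQ : Q (x 3) ≠ 0) (hd : x 2 - x 3 ≠ 0)
    (hW : 1 - x 2 ^ 2 * x 3 ^ 2 ≠ 0) :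
    (plebanskiDemianski P Q x)⁻¹ = pdInverse P Q x := by
  apply Matrix.inv_eq_right_inv
  rw [plebanskiDemianski_eq]
  ext i j
  fin_cases i <;> fin_cases j <;>
    simp [pdInverse, Matrix.mul_apply, Fin.sum_univ_four, pdU, pdW] <;>
    field_simp <;> ring

/-- The Christoffel symbols of the Plebański-Demiański metric. -/
def pdChristoffel (P P₁ Q Q₁ : ℝ → ℝ) (x : Fin 4 → ℝ) : Fin 4 → Matrix (Fin 4) (Fin 4) ℝ :=
  let p := x 2
  let q := x 3
  let u := pdU x
  let w := pdW x
  let γ := p * w * (Q q * (P p)⁻¹)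
  let δ := 1 / 2 * (P₁ p * (P p)⁻¹) + p * q ^ 2 * w
  let ε := 1 / 2 * (Q₁ q * (Q q)⁻¹) + p ^ 2 * q * w
  let ζ := q * w * (P p * (Q q)⁻¹)
  let κ := p * q ^ 2 * w - u
  let μ := p ^ 2 * q * w + u
  let A := -(1 / 2) * P p * w ^ 2
  let B := (1 / 2) * Q q * w ^ 2
  let a₀₂ := w * (p ^ 2 * (γ - q ^ 2 * δ)) - u
  let a₁₂ := w * (p ^ 2 * (δ - p ^ 2 * γ) - p)
  let b₀₂ := w * (γ - q ^ 2 * δ)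
  let b₁₂ := w * (δ - p ^ 2 * γ - p * q ^ 2) - u
  let a₀₃ := w * (ε - q ^ 2 * ζ - p ^ 2 * q) + u
  let a₁₃ := w * (ζ - p ^ 2 * ε)
  let b₀₃ := w * (q ^ 2 * (ε - q ^ 2 * ζ) - q)
  let b₁₃ := w * (q ^ 2 * (ζ - p ^ 2 * ε)) + u
  let c₀₀ := A * (2 * κ * (P p * (q ^ 2) ^ 2 - Q q) + P₁ p * (q ^ 2) ^ 2)
  let c₀₁ := A * (2 * κ * (Q q * p ^ 2 - P p * q ^ 2) + 2 * p * Q q - P₁ p * q ^ 2)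
  let c₁₁ := A * (2 * κ * (P p - Q q * (p ^ 2) ^ 2) - 4 * (p * p ^ 2) * Q q + P₁ p)
  let d₀₀ := B * (2 * μ * (P p * (q ^ 2) ^ 2 - Q q) + 4 * (q * q ^ 2) * P p - Q₁ q)
  let d₀₁ := B * (2 * μ * (Q q * p ^ 2 - P p * q ^ 2) - 2 * q * P p + Q₁ q * p ^ 2)
  let d₁₁ := B * (2 * μ * (P p - Q q * (p ^ 2) ^ 2) - Q₁ q * (p ^ 2) ^ 2)
  ![!![0, 0, a₀₂, a₀₃; 0, 0, a₁₂, a₁₃; a₀₂, a₁₂, 0, 0; a₀₃, a₁₃, 0, 0],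
    !![0, 0, b₀₂, b₀₃; 0, 0, b₁₂, b₁₃; b₀₂, b₁₂, 0, 0; b₀₃, b₁₃, 0, 0],
    !![c₀₀, c₀₁, 0, 0; c₀₁, c₁₁, 0, 0;
       0, 0, -(p * q ^ 2 * w + u) - 1 / 2 * (P₁ p * (P p)⁻¹), u - p ^ 2 * q * w;
       0, 0, u - p ^ 2 * q * w, -(P p * (Q q)⁻¹ * (u + p * q ^ 2 * w))],
    !![d₀₀, d₀₁, 0, 0; d₀₁, d₁₁, 0, 0;
       0, 0, Q q * (P p)⁻¹ * (u - p ^ 2 * q * w), -(p * q ^ 2 * w + u);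
       0, 0, -(p * q ^ 2 * w + u), u - p ^ 2 * q * w - 1 / 2 * (Q₁ q * (Q q)⁻¹)]]

namespace PDRegularAt

theorem grad_U (h : PDRegularAt P P₁ P₂ Q Q₁ Q₂ x) : HasGrad pdU (-pdU x ^ 2) (pdU x ^ 2) x := by
  have := h.sub_ne
  exact ((HasGrad.coord_two.sub HasGrad.coord_three).inv h.sub_ne).congr_grad
    (by simp [pdU]; field_simp) (by simp [pdU])

theorem grad_W (h : PDRegularAt P P₁ P₂ Q Q₁ Q₂ x) :
    HasGrad pdW (2 * x 2 * x 3 ^ 2 * pdW x ^ 2) (2 * x 2 ^ 2 * x 3 * pdW x ^ 2) x := by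
  have := h.W_ne
  exact (((HasGrad.const 1).sub (HasGrad.coord_two.sq.mul HasGrad.coord_three.sq)).inv
    h.W_ne).congr_grad
    (by simp [pdW]; field_simp) (by simp [pdW]; field_simp)

theorem grad_P (h : PDRegularAt P P₁ P₂ Q Q₁ Q₂ x) :
    HasGrad (fun y => P (y 2)) (P₁ (x 2)) 0 x :=
  (HasGrad.coord_two.comp h.hP).congr_grad (by simp) (by simp)

theorem grad_P₁ (h : PDRegularAt P P₁ P₂ Q Q₁ Q₂ x) :
    HasGrad (fun y => P₁ (y 2)) (P₂ (x 2)) 0 x :=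
  (HasGrad.coord_two.comp h.hP₁).congr_grad (by simp) (by simp)

theorem grad_Q (h : PDRegularAt P P₁ P₂ Q Q₁ Q₂ x) :
    HasGrad (fun y => Q (y 3)) 0 (Q₁ (x 3)) x :=
  (HasGrad.coord_three.comp h.hQ).congr_grad (by simp) (by simp)

theorem grad_Q₁ (h : PDRegularAt P P₁ P₂ Q Q₁ Q₂ x) :
    HasGrad (fun y => Q₁ (y 3)) 0 (Q₂ (x 3)) x :=
  (HasGrad.coord_three.comp h.hQ₁).congr_grad (by simp) (by simp)

theorem grad_Pinv (h : PDRegularAt P P₁ P₂ Q Q₁ Q₂ x) :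
    HasGrad (fun y => (P (y 2))⁻¹) (-(P₁ (x 2) * (P (x 2))⁻¹ ^ 2)) 0 x :=
  (h.grad_P.inv h.P_ne).congr_grad (by ring) (by simp)

theorem grad_Qinv (h : PDRegularAt P P₁ P₂ Q Q₁ Q₂ x) :
    HasGrad (fun y => (Q (y 3))⁻¹) 0 (-(Q₁ (x 3) * (Q (x 3))⁻¹ ^ 2)) x :=
  (h.grad_Q.inv h.Q_ne).congr_grad (by simp) (by ring)

/-- The `p`- and `q`-derivatives of the components of the metric. -/
theorem grad_metric (h : PDRegularAt P P₁ P₂ Q Q₁ Q₂ x) (i j : Fin 4) :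
    HasGrad (fun y => plebanskiDemianski P Q y i j)
      ((!![pdU x ^ 2 * pdW x * (2 * (x 2 * x 3 ^ 2 * pdW x - pdU x) *
            (P (x 2) * x 3 ^ 4 - Q (x 3)) + P₁ (x 2) * x 3 ^ 4),
           pdU x ^ 2 * pdW x * (2 * (x 2 * x 3 ^ 2 * pdW x - pdU x) *
            (Q (x 3) * x 2 ^ 2 - P (x 2) * x 3 ^ 2) + 2 * x 2 * Q (x 3) - P₁ (x 2) * x 3 ^ 2),
           0, 0;
           pdU x ^ 2 * pdW x * (2 * (x 2 * x 3 ^ 2 * pdW x - pdU x) *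
            (Q (x 3) * x 2 ^ 2 - P (x 2) * x 3 ^ 2) + 2 * x 2 * Q (x 3) - P₁ (x 2) * x 3 ^ 2),
           pdU x ^ 2 * pdW x * (2 * (x 2 * x 3 ^ 2 * pdW x - pdU x) *
            (P (x 2) - Q (x 3) * x 2 ^ 4) - 4 * x 2 ^ 3 * Q (x 3) + P₁ (x 2)), 0, 0;
           0, 0, pdU x ^ 2 * (P (x 2))⁻¹ * (-2 * (pdU x * (1 - x 2 ^ 2 * x 3 ^ 2)
            + x 2 * x 3 ^ 2) - (1 - x 2 ^ 2 * x 3 ^ 2) * P₁ (x 2) * (P (x 2))⁻¹), 0;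
           0, 0, 0, pdU x ^ 2 * (Q (x 3))⁻¹ * (2 * (pdU x * (1 - x 2 ^ 2 * x 3 ^ 2)
            + x 2 * x 3 ^ 2))] : Matrix (Fin 4) (Fin 4) ℝ) i j)
      ((!![pdU x ^ 2 * pdW x * (2 * (x 2 ^ 2 * x 3 * pdW x + pdU x) *
            (P (x 2) * x 3 ^ 4 - Q (x 3)) + 4 * x 3 ^ 3 * P (x 2) - Q₁ (x 3)),
           pdU x ^ 2 * pdW x * (2 * (x 2 ^ 2 * x 3 * pdW x + pdU x) *
            (Q (x 3) * x 2 ^ 2 - P (x 2) * x 3 ^ 2) - 2 * x 3 * P (x 2) + Q₁ (x 3) * x 2 ^ 2),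
           0, 0;
           pdU x ^ 2 * pdW x * (2 * (x 2 ^ 2 * x 3 * pdW x + pdU x) *
            (Q (x 3) * x 2 ^ 2 - P (x 2) * x 3 ^ 2) - 2 * x 3 * P (x 2) + Q₁ (x 3) * x 2 ^ 2),
           pdU x ^ 2 * pdW x * (2 * (x 2 ^ 2 * x 3 * pdW x + pdU x) *
            (P (x 2) - Q (x 3) * x 2 ^ 4) - Q₁ (x 3) * x 2 ^ 4), 0, 0;
           0, 0, pdU x ^ 2 * (P (x 2))⁻¹ * (2 * (pdU x * (1 - x 2 ^ 2 * x 3 ^ 2)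
            - x 2 ^ 2 * x 3)), 0;
           0, 0, 0, pdU x ^ 2 * (Q (x 3))⁻¹ * (-2 * (pdU x * (1 - x 2 ^ 2 * x 3 ^ 2)
            - x 2 ^ 2 * x 3) + (1 - x 2 ^ 2 * x 3 ^ 2) * Q₁ (x 3) * (Q (x 3))⁻¹)] :
          Matrix (Fin 4) (Fin 4) ℝ) i j) x := by
  have hp : HasGrad (fun y => y 2) 1 0 x := HasGrad.coord_two
  have hq : HasGrad (fun y => y 3) 0 1 x := HasGrad.coord_three
  have hA := h.grad_U.sq.mul h.grad_W
  have hB := h.grad_U.sq.mul ((HasGrad.const 1).sub (hp.sq.mul hq.sq))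
  have h00 := hA.mul ((h.grad_P.mul hq.sq.sq).sub h.grad_Q)
  have h01 := hA.mul ((h.grad_Q.mul hp.sq).sub (h.grad_P.mul hq.sq))
  have h11 := hA.mul (h.grad_P.sub (h.grad_Q.mul hp.sq.sq))
  have h22 := hB.mul h.grad_Pinv
  have h33 := (hB.mul h.grad_Qinv).neg
  simp only [plebanskiDemianski_eq]
  fin_cases i <;> fin_cases j <;> simp only [Fin.zero_eta, Fin.mk_one, Fin.reduceFinMk,
    Matrix.of_apply, Matrix.cons_val', Matrix.cons_val_zero, Matrix.cons_val_one,
    Matrix.cons_val_fin_one, Matrix.cons_val]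
  · exact h00.congr_grad (by ring) (by ring)
  · exact h01.congr_grad (by ring) (by ring)
  · exact HasGrad.const 0
  · exact HasGrad.const 0
  · exact h01.congr_grad (by ring) (by ring)
  · exact h11.congr_grad (by ring) (by ring)
  · exact HasGrad.const 0
  · exact HasGrad.const 0
  · exact HasGrad.const 0
  · exact HasGrad.const 0
  · exact h22.congr_grad (by ring) (by ring)
  · exact HasGrad.const 0
  · exact HasGrad.const 0
  · exact HasGrad.const 0
  · exact HasGrad.const 0
  · exact h33.congr_grad (by ring) (by ring)

end PDRegularAt

end

section

variable {P P₁ P₂ Q Q₁ Q₂ : ℝ → ℝ} {x : Fin 4 → ℝ}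

namespace PDRegularAt

theorem inv_eq (h : PDRegularAt P P₁ P₂ Q Q₁ Q₂ x) :
    (plebanskiDemianski P Q x)⁻¹ = pdInverse P Q x :=
  plebanskiDemianski_inv h.P_ne h.Q_ne h.sub_ne h.W_ne

set_option maxHeartbeats 4000000 in
theorem christoffel_eq (h : PDRegularAt P P₁ P₂ Q Q₁ Q₂ x) (k i j : Fin 4) :
    christoffel (plebanskiDemianski P Q) k i j x = pdChristoffel P P₁ Q Q₁ x k i j := by
  have hd := h.sub_ne
  have hW := h.W_ne
  have hP := h.P_ne
  have hQ := h.Q_ne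
  have hg (i j k : Fin 4) := (h.grad_metric i j).pderiv_eq k
  simp only [christoffel, hg, h.inv_eq, pdInverse, Fin.sum_univ_four]
  fin_cases k <;> fin_cases i <;> fin_cases j <;>
    simp [pdChristoffel, pdU, pdW] <;> field_simp <;> ring

end PDRegularAt
end

/-! ### The Ricci tensor and the scalar curvature -/

theorem pderiv4_eq_zero_of_forall_add_smul {f : (Fin 4 → ℝ) → ℝ} {x : Fin 4 → ℝ} {i : Fin 4}
    (h : ∀ t : ℝ, f (x + t • Pi.single i 1) = f x) : pderiv4 i f x = 0 := by
  by_cases hf : DifferentiableAt ℝ f x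
  · rw [pderiv4, ← hf.lineDeriv_eq_fderiv, lineDeriv]
    simp only [h, deriv_const]
  · rw [pderiv4, fderiv_zero_of_not_differentiableAt hf]
    simp

theorem pderiv4_congr {f g : (Fin 4 → ℝ) → ℝ} {x : Fin 4 → ℝ} (h : f =ᶠ[nhds x] g) (i : Fin 4) :
    pderiv4 i f x = pderiv4 i g x := by
  rw [pderiv4, pderiv4, h.fderiv_eq]

/-- The double eigenvalue of the Ricci tensor on the span of `θ` and `dq`. -/
def pdRicciQ (P P₁ Q Q₁ Q₂ : ℝ → ℝ) (x : Fin 4 → ℝ) : ℝ :=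
  let p := x 2
  let q := x 3
  pdW x ^ 2 * ((p - q) ^ 2 / 2 * (1 - p ^ 2 * q ^ 2) * Q₂ q
    + (p - q) * (2 - 3 * p ^ 2 * q ^ 2 + p ^ 3 * q) * Q₁ q
    + (3 - 6 * p ^ 2 * q ^ 2 - p ^ 4 + 4 * p ^ 3 * q) * Q q
    + (p - q) * (1 - p * q ^ 3) * P₁ p - (3 + q ^ 4 - 4 * p * q ^ 3) * P p)

/-- The double eigenvalue of the Ricci tensor on the span of `η` and `dp`. -/
def pdRicciP (P P₁ P₂ Q Q₁ : ℝ → ℝ) (x : Fin 4 → ℝ) : ℝ :=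
  let p := x 2
  let q := x 3
  pdW x ^ 2 * (-((p - q) ^ 2 / 2 * (1 - p ^ 2 * q ^ 2) * P₂ p)
    + (p - q) * (2 - 3 * p ^ 2 * q ^ 2 + p * q ^ 3) * P₁ p
    - (3 - 6 * p ^ 2 * q ^ 2 - q ^ 4 + 4 * p * q ^ 3) * P p
    + (p - q) * (1 - p ^ 3 * q) * Q₁ q + (3 + p ^ 4 - 4 * p ^ 3 * q) * Q q)

/-- The symmetric tensor with eigenvalue `r` on the span of `θ`, `dq` and `s` on that of
`η`, `dp`. -/
def pdDiagonal (P Q : ℝ → ℝ) (r s : ℝ) (x : Fin 4 → ℝ) : Matrix (Fin 4) (Fin 4) ℝ :=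
  !![pdU x ^ 2 * pdW x * (s * P (x 2) * x 3 ^ 4 - r * Q (x 3)),
     pdU x ^ 2 * pdW x * (r * Q (x 3) * x 2 ^ 2 - s * P (x 2) * x 3 ^ 2), 0, 0;
     pdU x ^ 2 * pdW x * (r * Q (x 3) * x 2 ^ 2 - s * P (x 2) * x 3 ^ 2),
     pdU x ^ 2 * pdW x * (s * P (x 2) - r * Q (x 3) * x 2 ^ 4), 0, 0;
     0, 0, s * pdU x ^ 2 * (1 - x 2 ^ 2 * x 3 ^ 2) * (P (x 2))⁻¹, 0;
     0, 0, 0, -(r * pdU x ^ 2 * (1 - x 2 ^ 2 * x 3 ^ 2) * (Q (x 3))⁻¹)]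

section

variable {P P₁ P₂ Q Q₁ Q₂ : ℝ → ℝ} {x : Fin 4 → ℝ}

namespace PDRegularAt

/-- The closed form must hold near `x`, not just at `x`, before it can be differentiated; hence the
eventual hypothesis. The entries of `pdChristoffel` are written with `(q ^ 2) ^ 2`, `p * p ^ 2` and
the like so that they match, up to unfolding, the functions assembled by the `HasGrad` combinators
in the proofs below. -/
theorem pderiv_christoffel (hn : ∀ᶠ y in nhds x, PDRegularAt P P₁ P₂ Q Q₁ Q₂ y)
    {k i j : Fin 4} {a b : ℝ}
    (hG : HasGrad (fun y => pdChristoffel P P₁ Q Q₁ y k i j) a b x) (m : Fin 4) :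
    pderiv4 m (christoffel (plebanskiDemianski P Q) k i j) x = (![0, 0, a, b] : Fin 4 → ℝ) m :=
  (hG.congr_of_eventuallyEq (hn.mono fun _ hy => hy.christoffel_eq k i j)).pderiv_eq m

/-- ∂_τ and ∂_φ are Killing fields: the closed forms are invariant under translation in these two
coordinates, so no gradient has to be computed. -/
theorem pderiv_christoffel_killing (hn : ∀ᶠ y in nhds x, PDRegularAt P P₁ P₂ Q Q₁ Q₂ y)
    (k i j : Fin 4) :
    pderiv4 0 (christoffel (plebanskiDemianski P Q) k i j) x = 0 ∧
    pderiv4 1 (christoffel (plebanskiDemianski P Q) k i j) x = 0 := by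
  have he : christoffel (plebanskiDemianski P Q) k i j =ᶠ[nhds x]
      fun y => pdChristoffel P P₁ Q Q₁ y k i j := hn.mono fun _ hy => hy.christoffel_eq k i j
  rw [pderiv4_congr he, pderiv4_congr he]
  constructor <;> apply pderiv4_eq_zero_of_forall_add_smul <;> intro t <;>
    simp [pdChristoffel, pdU, pdW]

theorem grad_γ (h : PDRegularAt P P₁ P₂ Q Q₁ Q₂ x) :
    HasGrad (fun y => y 2 * pdW y * (Q (y 3) * (P (y 2))⁻¹))
      ((pdW x + 2 * x 2 ^ 2 * x 3 ^ 2 * pdW x ^ 2) * (Q (x 3) * (P (x 2))⁻¹)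
        - x 2 * pdW x * (Q (x 3) * P₁ (x 2) * (P (x 2))⁻¹ ^ 2))
      (2 * x 2 ^ 3 * x 3 * pdW x ^ 2 * (Q (x 3) * (P (x 2))⁻¹)
        + x 2 * pdW x * (Q₁ (x 3) * (P (x 2))⁻¹)) x :=
  ((HasGrad.coord_two.mul h.grad_W).mul (h.grad_Q.mul h.grad_Pinv)).congr_grad
    (by ring) (by ring)

theorem grad_δ (h : PDRegularAt P P₁ P₂ Q Q₁ Q₂ x) :
    HasGrad (fun y => 1 / 2 * (P₁ (y 2) * (P (y 2))⁻¹) + y 2 * y 3 ^ 2 * pdW y)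
      (1 / 2 * (P₂ (x 2) * (P (x 2))⁻¹ - P₁ (x 2) ^ 2 * (P (x 2))⁻¹ ^ 2)
        + x 3 ^ 2 * pdW x + 2 * x 2 ^ 2 * x 3 ^ 4 * pdW x ^ 2)
      (2 * x 2 * x 3 * pdW x + 2 * x 2 ^ 3 * x 3 ^ 3 * pdW x ^ 2) x :=
  (((HasGrad.const (1 / 2)).mul (h.grad_P₁.mul h.grad_Pinv)).add
    ((HasGrad.coord_two.mul HasGrad.coord_three.sq).mul h.grad_W)).congr_grad (by ring) (by ring)

theorem grad_ε (h : PDRegularAt P P₁ P₂ Q Q₁ Q₂ x) :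
    HasGrad (fun y => 1 / 2 * (Q₁ (y 3) * (Q (y 3))⁻¹) + y 2 ^ 2 * y 3 * pdW y)
      (2 * x 2 * x 3 * pdW x + 2 * x 2 ^ 3 * x 3 ^ 3 * pdW x ^ 2)
      (1 / 2 * (Q₂ (x 3) * (Q (x 3))⁻¹ - Q₁ (x 3) ^ 2 * (Q (x 3))⁻¹ ^ 2)
        + x 2 ^ 2 * pdW x + 2 * x 2 ^ 4 * x 3 ^ 2 * pdW x ^ 2) x :=
  (((HasGrad.const (1 / 2)).mul (h.grad_Q₁.mul h.grad_Qinv)).add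
    ((HasGrad.coord_two.sq.mul HasGrad.coord_three).mul h.grad_W)).congr_grad (by ring) (by ring)

theorem grad_ζ (h : PDRegularAt P P₁ P₂ Q Q₁ Q₂ x) :
    HasGrad (fun y => y 3 * pdW y * (P (y 2) * (Q (y 3))⁻¹))
      (2 * x 2 * x 3 ^ 3 * pdW x ^ 2 * (P (x 2) * (Q (x 3))⁻¹)
        + x 3 * pdW x * (P₁ (x 2) * (Q (x 3))⁻¹))
      ((pdW x + 2 * x 2 ^ 2 * x 3 ^ 2 * pdW x ^ 2) * (P (x 2) * (Q (x 3))⁻¹)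
        - x 3 * pdW x * (P (x 2) * Q₁ (x 3) * (Q (x 3))⁻¹ ^ 2)) x :=
  ((HasGrad.coord_three.mul h.grad_W).mul (h.grad_P.mul h.grad_Qinv)).congr_grad
    (by ring) (by ring)

theorem grad_pqqw (h : PDRegularAt P P₁ P₂ Q Q₁ Q₂ x) :
    HasGrad (fun y => y 2 * y 3 ^ 2 * pdW y)
      (x 3 ^ 2 * pdW x + 2 * x 2 ^ 2 * x 3 ^ 4 * pdW x ^ 2)
      (2 * x 2 * x 3 * pdW x + 2 * x 2 ^ 3 * x 3 ^ 3 * pdW x ^ 2) x :=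
  ((HasGrad.coord_two.mul HasGrad.coord_three.sq).mul h.grad_W).congr_grad (by ring) (by ring)

theorem grad_ppqw (h : PDRegularAt P P₁ P₂ Q Q₁ Q₂ x) :
    HasGrad (fun y => y 2 ^ 2 * y 3 * pdW y)
      (2 * x 2 * x 3 * pdW x + 2 * x 2 ^ 3 * x 3 ^ 3 * pdW x ^ 2)
      (x 2 ^ 2 * pdW x + 2 * x 2 ^ 4 * x 3 ^ 2 * pdW x ^ 2) x :=
  ((HasGrad.coord_two.sq.mul HasGrad.coord_three).mul h.grad_W).congr_grad (by ring) (by ring)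

end PDRegularAt
end

section

variable {P P₁ P₂ Q Q₁ Q₂ : ℝ → ℝ} {x : Fin 4 → ℝ}

namespace PDRegularAt

set_option maxHeartbeats 2000000 in
theorem ricciTensor_two_two (hn : ∀ᶠ y in nhds x, PDRegularAt P P₁ P₂ Q Q₁ Q₂ y) :
    ricciTensor (plebanskiDemianski P Q) 2 2 x =
      pdRicciP P P₁ P₂ Q Q₁ x * pdU x ^ 2 * (1 - x 2 ^ 2 * x 3 ^ 2) * (P (x 2))⁻¹ := by
  have h := hn.self_of_nhds
  have hd := h.sub_ne
  have hW := h.W_ne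
  have hP := h.P_ne
  have hQ := h.Q_ne
  have hp : HasGrad (fun y => y 2) 1 0 x := HasGrad.coord_two
  have hq : HasGrad (fun y => y 3) 0 1 x := HasGrad.coord_three
  have e0 (k i j) := (pderiv_christoffel_killing hn k i j).1
  have e1 (k i j) := (pderiv_christoffel_killing hn k i j).2
  -- Among ∂_k Γ^k_{22} - ∂_2 Γ^k_{k2}, the terms with k = 2 cancel and the derivatives along τ and
  -- φ vanish; these four derivatives are what is left. The other components are treated in the same
  -- way.
  have a1 := pderiv_christoffel hn (k := 0) (i := 0) (j := 2)
    ((h.grad_W.mul (hp.sq.mul (h.grad_γ.sub (hq.sq.mul h.grad_δ)))).sub h.grad_U) 2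
  have a2 := pderiv_christoffel hn (k := 1) (i := 1) (j := 2)
    ((h.grad_W.mul ((h.grad_δ.sub (hp.sq.mul h.grad_γ)).sub (hp.mul hq.sq))).sub h.grad_U) 2
  have a3 := pderiv_christoffel hn (k := 3) (i := 3) (j := 2)
    ((h.grad_pqqw.add h.grad_U).neg) 2
  have a4 := pderiv_christoffel hn (k := 3) (i := 2) (j := 2)
    ((h.grad_Q.mul h.grad_Pinv).mul (h.grad_U.sub h.grad_ppqw)) 3
  simp only [Matrix.cons_val] at a1 a2 a3 a4
  simp only [ricciTensor, riemannTensor, Fin.sum_univ_four, e0, e1, a1, a2, a3, a4,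
    h.christoffel_eq]
  simp only [pdChristoffel, pdRicciP, Matrix.of_apply, Matrix.cons_val',
    Matrix.cons_val_zero, Matrix.cons_val_one, Matrix.cons_val_fin_one, Matrix.cons_val, mul_zero,
    zero_mul, sub_zero, add_zero, zero_add, sub_self, pdU, pdW]
  field_simp
  ring

set_option maxHeartbeats 2000000 in
theorem ricciTensor_three_three (hn : ∀ᶠ y in nhds x, PDRegularAt P P₁ P₂ Q Q₁ Q₂ y) :
    ricciTensor (plebanskiDemianski P Q) 3 3 x =
      -(pdRicciQ P P₁ Q Q₁ Q₂ x * pdU x ^ 2 * (1 - x 2 ^ 2 * x 3 ^ 2) * (Q (x 3))⁻¹) := by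
  have h := hn.self_of_nhds
  have hd := h.sub_ne
  have hW := h.W_ne
  have hP := h.P_ne
  have hQ := h.Q_ne
  have hp : HasGrad (fun y => y 2) 1 0 x := HasGrad.coord_two
  have hq : HasGrad (fun y => y 3) 0 1 x := HasGrad.coord_three
  have e0 (k i j) := (pderiv_christoffel_killing hn k i j).1
  have e1 (k i j) := (pderiv_christoffel_killing hn k i j).2
  have a1 := pderiv_christoffel hn (k := 0) (i := 0) (j := 3)
    ((h.grad_W.mul ((h.grad_ε.sub (hq.sq.mul h.grad_ζ)).sub (hp.sq.mul hq))).add h.grad_U) 3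
  have a2 := pderiv_christoffel hn (k := 1) (i := 1) (j := 3)
    ((h.grad_W.mul (hq.sq.mul (h.grad_ζ.sub (hp.sq.mul h.grad_ε)))).add h.grad_U) 3
  have a3 := pderiv_christoffel hn (k := 2) (i := 2) (j := 3)
    (h.grad_U.sub h.grad_ppqw) 3
  have a4 := pderiv_christoffel hn (k := 2) (i := 3) (j := 3)
    (((h.grad_P.mul h.grad_Qinv).mul (h.grad_U.add h.grad_pqqw)).neg) 2
  simp only [Matrix.cons_val] at a1 a2 a3 a4
  simp only [ricciTensor, riemannTensor, Fin.sum_univ_four, e0, e1, a1, a2, a3, a4,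
    h.christoffel_eq]
  simp only [pdChristoffel, pdRicciQ, Matrix.of_apply, Matrix.cons_val',
    Matrix.cons_val_zero, Matrix.cons_val_one, Matrix.cons_val_fin_one, Matrix.cons_val, mul_zero,
    zero_mul, sub_zero, add_zero, zero_add, sub_self, pdU, pdW]
  field_simp
  ring

set_option maxHeartbeats 2000000 in
theorem ricciTensor_two_three (hn : ∀ᶠ y in nhds x, PDRegularAt P P₁ P₂ Q Q₁ Q₂ y) :
    ricciTensor (plebanskiDemianski P Q) 2 3 x = 0 := by
  have h := hn.self_of_nhds
  have hd := h.sub_ne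
  have hW := h.W_ne
  have hP := h.P_ne
  have hQ := h.Q_ne
  have hp : HasGrad (fun y => y 2) 1 0 x := HasGrad.coord_two
  have hq : HasGrad (fun y => y 3) 0 1 x := HasGrad.coord_three
  have e0 (k i j) := (pderiv_christoffel_killing hn k i j).1
  have e1 (k i j) := (pderiv_christoffel_killing hn k i j).2
  have a1 := pderiv_christoffel hn (k := 0) (i := 0) (j := 2)
    ((h.grad_W.mul (hp.sq.mul (h.grad_γ.sub (hq.sq.mul h.grad_δ)))).sub h.grad_U) 3
  have a2 := pderiv_christoffel hn (k := 1) (i := 1) (j := 2)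
    ((h.grad_W.mul ((h.grad_δ.sub (hp.sq.mul h.grad_γ)).sub (hp.mul hq.sq))).sub h.grad_U) 3
  have a3 := pderiv_christoffel hn (k := 3) (i := 3) (j := 2)
    ((h.grad_pqqw.add h.grad_U).neg) 3
  have a4 := pderiv_christoffel hn (k := 2) (i := 2) (j := 2)
    ((h.grad_pqqw.add h.grad_U).neg.sub ((HasGrad.const (1 / 2)).mul (h.grad_P₁.mul h.grad_Pinv))) 3
  have a5 := pderiv_christoffel hn (k := 2) (i := 3) (j := 2)
    (h.grad_U.sub h.grad_ppqw) 2
  simp only [Matrix.cons_val] at a1 a2 a3 a4 a5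
  simp only [ricciTensor, riemannTensor, Fin.sum_univ_four, e0, e1, a1, a2, a3, a4, a5,
    h.christoffel_eq]
  simp only [pdChristoffel, Matrix.of_apply, Matrix.cons_val',
    Matrix.cons_val_zero, Matrix.cons_val_one, Matrix.cons_val_fin_one, Matrix.cons_val, mul_zero,
    zero_mul, sub_zero, add_zero, zero_add, sub_self, pdU, pdW]
  field_simp
  ring

set_option maxHeartbeats 2000000 in
theorem ricciTensor_three_two (hn : ∀ᶠ y in nhds x, PDRegularAt P P₁ P₂ Q Q₁ Q₂ y) :
    ricciTensor (plebanskiDemianski P Q) 3 2 x = 0 := by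
  have h := hn.self_of_nhds
  have hd := h.sub_ne
  have hW := h.W_ne
  have hP := h.P_ne
  have hQ := h.Q_ne
  have hp : HasGrad (fun y => y 2) 1 0 x := HasGrad.coord_two
  have hq : HasGrad (fun y => y 3) 0 1 x := HasGrad.coord_three
  have e0 (k i j) := (pderiv_christoffel_killing hn k i j).1
  have e1 (k i j) := (pderiv_christoffel_killing hn k i j).2
  have a1 := pderiv_christoffel hn (k := 0) (i := 0) (j := 3)
    ((h.grad_W.mul ((h.grad_ε.sub (hq.sq.mul h.grad_ζ)).sub (hp.sq.mul hq))).add h.grad_U) 2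
  have a2 := pderiv_christoffel hn (k := 1) (i := 1) (j := 3)
    ((h.grad_W.mul (hq.sq.mul (h.grad_ζ.sub (hp.sq.mul h.grad_ε)))).add h.grad_U) 2
  have a3 := pderiv_christoffel hn (k := 2) (i := 2) (j := 3)
    (h.grad_U.sub h.grad_ppqw) 2
  have a4 := pderiv_christoffel hn (k := 3) (i := 3) (j := 3)
    ((h.grad_U.sub h.grad_ppqw).sub ((HasGrad.const (1 / 2)).mul (h.grad_Q₁.mul h.grad_Qinv))) 2
  have a5 := pderiv_christoffel hn (k := 3) (i := 2) (j := 3)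
    ((h.grad_pqqw.add h.grad_U).neg) 3
  simp only [Matrix.cons_val] at a1 a2 a3 a4 a5
  simp only [ricciTensor, riemannTensor, Fin.sum_univ_four, e0, e1, a1, a2, a3, a4, a5,
    h.christoffel_eq]
  simp only [pdChristoffel, Matrix.of_apply, Matrix.cons_val',
    Matrix.cons_val_zero, Matrix.cons_val_one, Matrix.cons_val_fin_one, Matrix.cons_val, mul_zero,
    zero_mul, sub_zero, add_zero, zero_add, sub_self, pdU, pdW]
  field_simp
  ring

set_option maxHeartbeats 2000000 in
theorem ricciTensor_zero_zero (hn : ∀ᶠ y in nhds x, PDRegularAt P P₁ P₂ Q Q₁ Q₂ y) :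
    ricciTensor (plebanskiDemianski P Q) 0 0 x =
      pdU x ^ 2 * pdW x *
        (pdRicciP P P₁ P₂ Q Q₁ x * P (x 2) * x 3 ^ 4 - pdRicciQ P P₁ Q Q₁ Q₂ x * Q (x 3)) := by
  have h := hn.self_of_nhds
  have hd := h.sub_ne
  have hW := h.W_ne
  have hP := h.P_ne
  have hQ := h.Q_ne
  have hq : HasGrad (fun y => y 3) 0 1 x := HasGrad.coord_three
  have hA := ((HasGrad.const (-(1 / 2))).mul h.grad_P).mul h.grad_W.sq
  have hB := ((HasGrad.const (1 / 2)).mul h.grad_Q).mul h.grad_W.sq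
  have hκ := ((HasGrad.const 2).mul (h.grad_pqqw.sub h.grad_U))
  have hμ := ((HasGrad.const 2).mul (h.grad_ppqw.add h.grad_U))
  have e0 (k i j) := (pderiv_christoffel_killing hn k i j).1
  have e1 (k i j) := (pderiv_christoffel_killing hn k i j).2
  have a1 := pderiv_christoffel hn (k := 2) (i := 0) (j := 0)
    (hA.mul ((hκ.mul ((h.grad_P.mul hq.sq.sq).sub h.grad_Q)).add (h.grad_P₁.mul hq.sq.sq))) 2
  have a2 := pderiv_christoffel hn (k := 3) (i := 0) (j := 0)
    (hB.mul (((hμ.mul ((h.grad_P.mul hq.sq.sq).sub h.grad_Q)).add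
      (((HasGrad.const 4).mul (hq.mul hq.sq)).mul h.grad_P)).sub h.grad_Q₁)) 3
  simp only [Matrix.cons_val] at a1 a2
  simp only [ricciTensor, riemannTensor, Fin.sum_univ_four, e0, e1, a1, a2,
    h.christoffel_eq]
  simp only [pdChristoffel, pdRicciP, pdRicciQ, Matrix.of_apply, Matrix.cons_val',
    Matrix.cons_val_zero, Matrix.cons_val_one, Matrix.cons_val_fin_one, Matrix.cons_val, mul_zero,
    zero_mul, sub_zero, add_zero, zero_add, sub_self, pdU, pdW]
  field_simp
  ring

set_option maxHeartbeats 2000000 in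
theorem ricciTensor_zero_one (hn : ∀ᶠ y in nhds x, PDRegularAt P P₁ P₂ Q Q₁ Q₂ y) :
    ricciTensor (plebanskiDemianski P Q) 0 1 x =
      pdU x ^ 2 * pdW x *
        (pdRicciQ P P₁ Q Q₁ Q₂ x * Q (x 3) * x 2 ^ 2
          - pdRicciP P P₁ P₂ Q Q₁ x * P (x 2) * x 3 ^ 2) := by
  have h := hn.self_of_nhds
  have hd := h.sub_ne
  have hW := h.W_ne
  have hP := h.P_ne
  have hQ := h.Q_ne
  have hp : HasGrad (fun y => y 2) 1 0 x := HasGrad.coord_two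
  have hq : HasGrad (fun y => y 3) 0 1 x := HasGrad.coord_three
  have hA := ((HasGrad.const (-(1 / 2))).mul h.grad_P).mul h.grad_W.sq
  have hB := ((HasGrad.const (1 / 2)).mul h.grad_Q).mul h.grad_W.sq
  have hκ := ((HasGrad.const 2).mul (h.grad_pqqw.sub h.grad_U))
  have hμ := ((HasGrad.const 2).mul (h.grad_ppqw.add h.grad_U))
  have e0 (k i j) := (pderiv_christoffel_killing hn k i j).1
  have e1 (k i j) := (pderiv_christoffel_killing hn k i j).2
  have a1 := pderiv_christoffel hn (k := 2) (i := 1) (j := 0)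
    (hA.mul (((hκ.mul ((h.grad_Q.mul hp.sq).sub (h.grad_P.mul hq.sq))).add
      (((HasGrad.const 2).mul hp).mul h.grad_Q)).sub (h.grad_P₁.mul hq.sq))) 2
  have a2 := pderiv_christoffel hn (k := 3) (i := 1) (j := 0)
    (hB.mul (((hμ.mul ((h.grad_Q.mul hp.sq).sub (h.grad_P.mul hq.sq))).sub
      (((HasGrad.const 2).mul hq).mul h.grad_P)).add (h.grad_Q₁.mul hp.sq))) 3
  simp only [Matrix.cons_val] at a1 a2
  simp only [ricciTensor, riemannTensor, Fin.sum_univ_four, e0, e1, a1, a2,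
    h.christoffel_eq]
  simp only [pdChristoffel, pdRicciP, pdRicciQ, Matrix.of_apply, Matrix.cons_val',
    Matrix.cons_val_zero, Matrix.cons_val_one, Matrix.cons_val_fin_one, Matrix.cons_val, mul_zero,
    zero_mul, sub_zero, add_zero, zero_add, sub_self, pdU, pdW]
  field_simp
  ring

set_option maxHeartbeats 2000000 in
theorem ricciTensor_one_zero (hn : ∀ᶠ y in nhds x, PDRegularAt P P₁ P₂ Q Q₁ Q₂ y) :
    ricciTensor (plebanskiDemianski P Q) 1 0 x =
      pdU x ^ 2 * pdW x *
        (pdRicciQ P P₁ Q Q₁ Q₂ x * Q (x 3) * x 2 ^ 2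
          - pdRicciP P P₁ P₂ Q Q₁ x * P (x 2) * x 3 ^ 2) := by
  have h := hn.self_of_nhds
  have hd := h.sub_ne
  have hW := h.W_ne
  have hP := h.P_ne
  have hQ := h.Q_ne
  have hp : HasGrad (fun y => y 2) 1 0 x := HasGrad.coord_two
  have hq : HasGrad (fun y => y 3) 0 1 x := HasGrad.coord_three
  have hA := ((HasGrad.const (-(1 / 2))).mul h.grad_P).mul h.grad_W.sq
  have hB := ((HasGrad.const (1 / 2)).mul h.grad_Q).mul h.grad_W.sq
  have hκ := ((HasGrad.const 2).mul (h.grad_pqqw.sub h.grad_U))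
  have hμ := ((HasGrad.const 2).mul (h.grad_ppqw.add h.grad_U))
  have e0 (k i j) := (pderiv_christoffel_killing hn k i j).1
  have e1 (k i j) := (pderiv_christoffel_killing hn k i j).2
  have a1 := pderiv_christoffel hn (k := 2) (i := 0) (j := 1)
    (hA.mul (((hκ.mul ((h.grad_Q.mul hp.sq).sub (h.grad_P.mul hq.sq))).add
      (((HasGrad.const 2).mul hp).mul h.grad_Q)).sub (h.grad_P₁.mul hq.sq))) 2
  have a2 := pderiv_christoffel hn (k := 3) (i := 0) (j := 1)
    (hB.mul (((hμ.mul ((h.grad_Q.mul hp.sq).sub (h.grad_P.mul hq.sq))).sub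
      (((HasGrad.const 2).mul hq).mul h.grad_P)).add (h.grad_Q₁.mul hp.sq))) 3
  simp only [Matrix.cons_val] at a1 a2
  simp only [ricciTensor, riemannTensor, Fin.sum_univ_four, e0, e1, a1, a2,
    h.christoffel_eq]
  simp only [pdChristoffel, pdRicciP, pdRicciQ, Matrix.of_apply, Matrix.cons_val',
    Matrix.cons_val_zero, Matrix.cons_val_one, Matrix.cons_val_fin_one, Matrix.cons_val, mul_zero,
    zero_mul, sub_zero, add_zero, zero_add, sub_self, pdU, pdW]
  field_simp
  ring

set_option maxHeartbeats 2000000 in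
theorem ricciTensor_one_one (hn : ∀ᶠ y in nhds x, PDRegularAt P P₁ P₂ Q Q₁ Q₂ y) :
    ricciTensor (plebanskiDemianski P Q) 1 1 x =
      pdU x ^ 2 * pdW x *
        (pdRicciP P P₁ P₂ Q Q₁ x * P (x 2) - pdRicciQ P P₁ Q Q₁ Q₂ x * Q (x 3) * x 2 ^ 4) := by
  have h := hn.self_of_nhds
  have hd := h.sub_ne
  have hW := h.W_ne
  have hP := h.P_ne
  have hQ := h.Q_ne
  have hp : HasGrad (fun y => y 2) 1 0 x := HasGrad.coord_two
  have hA := ((HasGrad.const (-(1 / 2))).mul h.grad_P).mul h.grad_W.sq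
  have hB := ((HasGrad.const (1 / 2)).mul h.grad_Q).mul h.grad_W.sq
  have hκ := ((HasGrad.const 2).mul (h.grad_pqqw.sub h.grad_U))
  have hμ := ((HasGrad.const 2).mul (h.grad_ppqw.add h.grad_U))
  have e0 (k i j) := (pderiv_christoffel_killing hn k i j).1
  have e1 (k i j) := (pderiv_christoffel_killing hn k i j).2
  have a1 := pderiv_christoffel hn (k := 2) (i := 1) (j := 1)
    (hA.mul (((hκ.mul (h.grad_P.sub (h.grad_Q.mul hp.sq.sq))).sub
      (((HasGrad.const 4).mul (hp.mul hp.sq)).mul h.grad_Q)).add h.grad_P₁)) 2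
  have a2 := pderiv_christoffel hn (k := 3) (i := 1) (j := 1)
    (hB.mul ((hμ.mul (h.grad_P.sub (h.grad_Q.mul hp.sq.sq))).sub (h.grad_Q₁.mul hp.sq.sq))) 3
  simp only [Matrix.cons_val] at a1 a2
  simp only [ricciTensor, riemannTensor, Fin.sum_univ_four, e0, e1, a1, a2,
    h.christoffel_eq]
  simp only [pdChristoffel, pdRicciP, pdRicciQ, Matrix.of_apply, Matrix.cons_val',
    Matrix.cons_val_zero, Matrix.cons_val_one, Matrix.cons_val_fin_one, Matrix.cons_val, mul_zero,
    zero_mul, sub_zero, add_zero, zero_add, sub_self, pdU, pdW]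
  field_simp
  ring

end PDRegularAt
end

section

variable {P P₁ P₂ Q Q₁ Q₂ : ℝ → ℝ} {x : Fin 4 → ℝ}

namespace PDRegularAt

/-- The reflection (τ, φ) ↦ (-τ, -φ) is an isometry, so components with an odd number of Killing
indices vanish. In the computation this shows up as Γ^k_{ij} = 0 whenever an odd number of k, i, j
lie in {0, 1}. -/
theorem ricciTensor_killing (hn : ∀ᶠ y in nhds x, PDRegularAt P P₁ P₂ Q Q₁ Q₂ y)
    {a b : Fin 4} (ha : a = 0 ∨ a = 1) (hb : b = 2 ∨ b = 3) :
    ricciTensor (plebanskiDemianski P Q) a b x = 0 ∧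
      ricciTensor (plebanskiDemianski P Q) b a x = 0 := by
  have h := hn.self_of_nhds
  have e0 (k i j) := (pderiv_christoffel_killing hn k i j).1
  have e1 (k i j) := (pderiv_christoffel_killing hn k i j).2
  have c (k i j m : Fin 4) (h0 : ∀ y, pdChristoffel P P₁ Q Q₁ y k i j = 0) :
      pderiv4 m (christoffel (plebanskiDemianski P Q) k i j) x = 0 := by
    rw [pderiv_christoffel hn (a := 0) (b := 0) (by simpa only [h0] using HasGrad.const 0)]
    fin_cases m <;> rfl
  have c1 (k m a : Fin 4) (ha : a = 0 ∨ a = 1) :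
      pderiv4 m (christoffel (plebanskiDemianski P Q) k k a) x = 0 := by
    refine c k k a m fun y => ?_
    rcases ha with rfl | rfl <;> fin_cases k <;> simp [pdChristoffel]
  -- If `k` is a Killing index the derivative along it is zero; otherwise `a` is the only Killing
  -- index and the symbol itself is identically zero.
  have c2 (k i a : Fin 4) (hi : i = 2 ∨ i = 3) (ha : a = 0 ∨ a = 1) :
      pderiv4 k (christoffel (plebanskiDemianski P Q) k i a) x = 0 ∧
        pderiv4 k (christoffel (plebanskiDemianski P Q) k a i) x = 0 := by
    rcases ha with rfl | rfl <;> rcases hi with rfl | rfl <;> fin_cases k <;>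
    first
    | exact ⟨e0 _ _ _, e0 _ _ _⟩
    | exact ⟨e1 _ _ _, e1 _ _ _⟩
    | exact ⟨c _ _ _ _ fun y => by simp [pdChristoffel],
        c _ _ _ _ fun y => by simp [pdChristoffel]⟩
  have e (k m b : Fin 4) (hm : m = 0 ∨ m = 1) :
      pderiv4 m (christoffel (plebanskiDemianski P Q) k k b) x = 0 := by
    rcases hm with rfl | rfl
    · exact e0 _ _ _
    · exact e1 _ _ _
  simp only [ricciTensor, riemannTensor, (c2 _ b a hb ha).1, (c2 _ b a hb ha).2, c1 _ _ a ha,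
    e _ a _ ha, h.christoffel_eq, Fin.sum_univ_four]
  rcases ha with rfl | rfl <;> rcases hb with rfl | rfl <;> constructor <;>
    simp [pdChristoffel]

theorem ricciTensor_eq (hn : ∀ᶠ y in nhds x, PDRegularAt P P₁ P₂ Q Q₁ Q₂ y) (a b : Fin 4) :
    ricciTensor (plebanskiDemianski P Q) a b x =
      pdDiagonal P Q (pdRicciQ P P₁ Q Q₁ Q₂ x) (pdRicciP P P₁ P₂ Q Q₁ x) x a b := by
  fin_cases a <;> fin_cases b
  · exact ricciTensor_zero_zero hn
  · exact ricciTensor_zero_one hn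
  · exact (ricciTensor_killing hn (.inl rfl) (.inl rfl)).1
  · exact (ricciTensor_killing hn (.inl rfl) (.inr rfl)).1
  · exact ricciTensor_one_zero hn
  · exact ricciTensor_one_one hn
  · exact (ricciTensor_killing hn (.inr rfl) (.inl rfl)).1
  · exact (ricciTensor_killing hn (.inr rfl) (.inr rfl)).1
  · exact (ricciTensor_killing hn (.inl rfl) (.inl rfl)).2
  · exact (ricciTensor_killing hn (.inr rfl) (.inl rfl)).2
  · exact ricciTensor_two_two hn
  · exact ricciTensor_two_three hn
  · exact (ricciTensor_killing hn (.inl rfl) (.inr rfl)).2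
  · exact (ricciTensor_killing hn (.inr rfl) (.inr rfl)).2
  · exact ricciTensor_three_two hn
  · exact ricciTensor_three_three hn

/-- Each of the two eigenvalues has multiplicity two. This one trace computation serves for R, for
F_{cd}F^{cd} and for g^{ab}g_{ab}. -/
theorem contract_pdDiagonal (h : PDRegularAt P P₁ P₂ Q Q₁ Q₂ x) (r s : ℝ) :
    ∑ a, ∑ b, (plebanskiDemianski P Q x)⁻¹ a b * pdDiagonal P Q r s x a b = 2 * (r + s) := by
  have hd := h.sub_ne
  have hW := h.W_ne
  have hP := h.P_ne
  have hQ := h.Q_ne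
  simp only [h.inv_eq, Fin.sum_univ_four]
  simp [pdInverse, pdDiagonal, pdU, pdW]
  field_simp
  ring

theorem scalarCurv_eq (hn : ∀ᶠ y in nhds x, PDRegularAt P P₁ P₂ Q Q₁ Q₂ y) :
    scalarCurv (plebanskiDemianski P Q) x =
      2 * (pdRicciQ P P₁ Q Q₁ Q₂ x + pdRicciP P P₁ P₂ Q Q₁ x) := by
  simp only [scalarCurv, ricciTensor_eq hn]
  exact hn.self_of_nhds.contract_pdDiagonal _ _

end PDRegularAt

/-- In the sum one of the two factors 1 / (1 - p²q²) cancels, so that clearing the other turns R =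
4λ into a linear equation with polynomial coefficients. -/
theorem pdRicciQ_add_pdRicciP (hW : 1 - x 2 ^ 2 * x 3 ^ 2 ≠ 0) :
    2 * (pdRicciQ P P₁ Q Q₁ Q₂ x + pdRicciP P P₁ P₂ Q Q₁ x) =
      ((x 2 - x 3) ^ 2 * (Q₂ (x 3) - P₂ (x 2)) + 6 * (x 2 - x 3) * (P₁ (x 2) + Q₁ (x 3))
        - 12 * (P (x 2) - Q (x 3))) * pdW x := by
  simp only [pdRicciQ, pdRicciP, pdW]
  field_simp
  ring

theorem pdDiagonal_one_one : pdDiagonal P Q 1 1 x = plebanskiDemianski P Q x := by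
  rw [plebanskiDemianski_eq]
  ext i j
  fin_cases i <;> fin_cases j <;>
    simp only [pdDiagonal, Fin.zero_eta, Fin.mk_one, Fin.reduceFinMk,
      Matrix.of_apply, Matrix.cons_val', Matrix.cons_val_zero, Matrix.cons_val_one,
      Matrix.cons_val_fin_one, Matrix.cons_val] <;> ring

/-- Linearity in the eigenvalues reduces a tensor identity between such tensors to two scalar ones,
with no case split on the indices. -/
theorem pdDiagonal_apply (r s : ℝ) (a b : Fin 4) : pdDiagonal P Q r s x a b =
    r * pdDiagonal P Q 1 0 x a b + s * pdDiagonal P Q 0 1 x a b := by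
  fin_cases a <;> fin_cases b <;>
    simp only [pdDiagonal, Fin.zero_eta, Fin.mk_one, Fin.reduceFinMk,
      Matrix.of_apply, Matrix.cons_val', Matrix.cons_val_zero, Matrix.cons_val_one,
      Matrix.cons_val_fin_one, Matrix.cons_val] <;> ring

/-! ### The Maxwell field -/

/-- The Maxwell field `α (1 + p q)⁻² (θ ∧ dq + η ∧ dp) + β (1 - p q)⁻² (θ ∧ dq - η ∧ dp)`. -/
def pdMaxwell (α β : ℝ) : Tensor2 := fun x =>
  let p := x 2
  let q := x 3
  let e := (1 + p * q)⁻¹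
  let f := (1 - p * q)⁻¹
  let r := α * e ^ 2 + β * f ^ 2
  let s := α * e ^ 2 - β * f ^ 2
  !![0, 0, -(q ^ 2 * s), r; 0, 0, s, -(p ^ 2 * r); q ^ 2 * s, -s, 0, 0; -r, p ^ 2 * r, 0, 0]

theorem one_add_mul_ne_zero {p q : ℝ} (h : 1 - p ^ 2 * q ^ 2 ≠ 0) : 1 + p * q ≠ 0 :=
  fun h0 => h (by linear_combination (1 - p * q) * h0)

theorem one_sub_mul_ne_zero {p q : ℝ} (h : 1 - p ^ 2 * q ^ 2 ≠ 0) : 1 - p * q ≠ 0 :=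
  fun h0 => h (by linear_combination (1 + p * q) * h0)

theorem pdMaxwell_skew (α β : ℝ) (x : Fin 4 → ℝ) (a b : Fin 4) :
    pdMaxwell α β x b a = -pdMaxwell α β x a b := by
  fin_cases a <;> fin_cases b <;> simp [pdMaxwell]

theorem isSmoothTwoForm_pdMaxwell (α β : ℝ) {U : Set (Fin 4 → ℝ)}
    (hW : ∀ x ∈ U, 1 - x 2 ^ 2 * x 3 ^ 2 ≠ 0) : IsSmoothTwoForm (pdMaxwell α β) U := by
  refine ⟨fun a b => ?_, fun x _ a b => pdMaxwell_skew α β x a b⟩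
  have hp : ContDiffOn ℝ ∞ (fun x : Fin 4 → ℝ => x 2) U := (contDiff_apply ℝ ℝ 2).contDiffOn
  have hq : ContDiffOn ℝ ∞ (fun x : Fin 4 → ℝ => x 3) U := (contDiff_apply ℝ ℝ 3).contDiffOn
  have he : ContDiffOn ℝ ∞ (fun x : Fin 4 → ℝ => α * (1 + x 2 * x 3)⁻¹ ^ 2) U :=
    contDiffOn_const.mul (((contDiffOn_const.add (hp.mul hq)).inv
      fun x hx => one_add_mul_ne_zero (hW x hx)).pow 2)
  have hf : ContDiffOn ℝ ∞ (fun x : Fin 4 → ℝ => β * (1 - x 2 * x 3)⁻¹ ^ 2) U :=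
    contDiffOn_const.mul (((contDiffOn_const.sub (hp.mul hq)).inv
      fun x hx => one_sub_mul_ne_zero (hW x hx)).pow 2)
  have hr := he.add hf
  have hs := he.sub hf
  fin_cases a <;> fin_cases b <;>
  first
  | exact contDiffOn_const
  | exact hr
  | exact hs
  | exact hr.neg
  | exact hs.neg
  | exact (hp.pow 2).mul hr
  | exact ((hp.pow 2).mul hr).neg
  | exact (hq.pow 2).mul hs
  | exact ((hq.pow 2).mul hs).neg

theorem grad_pdMaxwell (α β : ℝ) (hW : 1 - x 2 ^ 2 * x 3 ^ 2 ≠ 0) (i j : Fin 4) :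
    HasGrad (fun y => pdMaxwell α β y i j)
      (let e := (1 + x 2 * x 3)⁻¹
       let f := (1 - x 2 * x 3)⁻¹
       let r := -2 * α * x 3 * e ^ 3 + 2 * β * x 3 * f ^ 3
       let s := -2 * α * x 3 * e ^ 3 - 2 * β * x 3 * f ^ 3
       let t := 2 * x 2 * (α * e ^ 2 + β * f ^ 2)
       (!![0, 0, -(x 3 ^ 2 * s), r; 0, 0, s, -(x 2 ^ 2 * r + t); x 3 ^ 2 * s, -s, 0, 0;
          -r, x 2 ^ 2 * r + t, 0, 0] : Matrix (Fin 4) (Fin 4) ℝ) i j)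
      (let e := (1 + x 2 * x 3)⁻¹
       let f := (1 - x 2 * x 3)⁻¹
       let r := -2 * α * x 2 * e ^ 3 + 2 * β * x 2 * f ^ 3
       let s := -2 * α * x 2 * e ^ 3 - 2 * β * x 2 * f ^ 3
       let t := 2 * x 3 * (α * e ^ 2 - β * f ^ 2)
       (!![0, 0, -(x 3 ^ 2 * s + t), r; 0, 0, s, -(x 2 ^ 2 * r); x 3 ^ 2 * s + t, -s, 0, 0;
          -r, x 2 ^ 2 * r, 0, 0] : Matrix (Fin 4) (Fin 4) ℝ) i j) x := by
  have hp : HasGrad (fun y => y 2) 1 0 x := HasGrad.coord_two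
  have hq : HasGrad (fun y => y 3) 0 1 x := HasGrad.coord_three
  have h1 := one_add_mul_ne_zero hW
  have h2 := one_sub_mul_ne_zero hW
  have he : HasGrad (fun y => α * (1 + y 2 * y 3)⁻¹ ^ 2) (-2 * α * x 3 * (1 + x 2 * x 3)⁻¹ ^ 3)
      (-2 * α * x 2 * (1 + x 2 * x 3)⁻¹ ^ 3) x :=
    ((HasGrad.const α).mul (((HasGrad.const 1).add (hp.mul hq)).inv h1).sq).congr_grad
      (by field_simp; ring) (by field_simp; ring)
  have hf : HasGrad (fun y => β * (1 - y 2 * y 3)⁻¹ ^ 2) (2 * β * x 3 * (1 - x 2 * x 3)⁻¹ ^ 3)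
      (2 * β * x 2 * (1 - x 2 * x 3)⁻¹ ^ 3) x :=
    ((HasGrad.const β).mul (((HasGrad.const 1).sub (hp.mul hq)).inv h2).sq).congr_grad
      (by field_simp; ring) (by field_simp; ring)
  have hr := he.add hf
  have hs := he.sub hf
  have h02 := (hq.sq.mul hs).neg
  have h13 := (hp.sq.mul hr).neg
  have h20 := hq.sq.mul hs
  have h31 := hp.sq.mul hr
  generalize (1 + x 2 * x 3)⁻¹ = e at *
  generalize (1 - x 2 * x 3)⁻¹ = f at *
  fin_cases i <;> fin_cases j <;> simp only [Fin.zero_eta, Fin.mk_one, Fin.reduceFinMk,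
      Matrix.of_apply, Matrix.cons_val', Matrix.cons_val_zero, Matrix.cons_val_one,
      Matrix.cons_val_fin_one, Matrix.cons_val]
  · exact HasGrad.const 0
  · exact HasGrad.const 0
  · exact h02.congr_grad (by ring) (by ring)
  · exact hr.congr_grad (by ring) (by ring)
  · exact HasGrad.const 0
  · exact HasGrad.const 0
  · exact hs.congr_grad (by ring) (by ring)
  · exact h13.congr_grad (by ring) (by ring)
  · exact h20.congr_grad (by ring) (by ring)
  · exact hs.neg.congr_grad (by ring) (by ring)
  · exact HasGrad.const 0
  · exact HasGrad.const 0
  · exact hr.neg.congr_grad (by ring) (by ring)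
  · exact h31.congr_grad (by ring) (by ring)
  · exact HasGrad.const 0
  · exact HasGrad.const 0

namespace PDRegularAt

/-- The field is r θ ∧ dq + s η ∧ dp, and the planes of θ, dq and of η, dp are orthogonal. On each
plane the square is therefore a multiple of the metric, with factor (p - q)⁴ r² or (p - q)⁴ s². -/
theorem maxwellSquare_eq (h : PDRegularAt P P₁ P₂ Q Q₁ Q₂ x) (α β : ℝ) (a b : Fin 4) :
    maxwellSquare (plebanskiDemianski P Q) (pdMaxwell α β) a b x =
      pdDiagonal P Q
        ((x 2 - x 3) ^ 4 * (α * (1 + x 2 * x 3)⁻¹ ^ 2 + β * (1 - x 2 * x 3)⁻¹ ^ 2) ^ 2)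
        ((x 2 - x 3) ^ 4 * (α * (1 + x 2 * x 3)⁻¹ ^ 2 - β * (1 - x 2 * x 3)⁻¹ ^ 2) ^ 2)
        x a b := by
  have hd := h.sub_ne
  have hW := h.W_ne
  have hP := h.P_ne
  have hQ := h.Q_ne
  simp only [maxwellSquare, h.inv_eq, Fin.sum_univ_four, pdMaxwell]
  generalize α * (1 + x 2 * x 3)⁻¹ ^ 2 + β * (1 - x 2 * x 3)⁻¹ ^ 2 = r
  generalize α * (1 + x 2 * x 3)⁻¹ ^ 2 - β * (1 - x 2 * x 3)⁻¹ ^ 2 = s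
  fin_cases a <;> fin_cases b <;> simp [pdInverse, pdDiagonal, pdU, pdW] <;> field_simp <;> ring

/-- The connection is torsion-free: by symmetry of Γ and skewness of F the connection terms cancel
in pairs, leaving the exterior derivative. -/
theorem covDeriv2_cyclic (h : PDRegularAt P P₁ P₂ Q Q₁ Q₂ x) {F : Tensor2}
    (hF : ∀ a b, F x b a = -F x a b) (a b c : Fin 4) :
    covDeriv2 (plebanskiDemianski P Q) F a b c x + covDeriv2 (plebanskiDemianski P Q) F b c a x
      + covDeriv2 (plebanskiDemianski P Q) F c a b x =
    pderiv4 a (fun y => F y b c) x + pderiv4 b (fun y => F y c a) x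
      + pderiv4 c (fun y => F y a b) x := by
  have hs (k i j : Fin 4) : christoffel (plebanskiDemianski P Q) k i j x =
      christoffel (plebanskiDemianski P Q) k j i x := by
    rw [h.christoffel_eq, h.christoffel_eq]
    fin_cases k <;> fin_cases i <;> fin_cases j <;> rfl
  have e (d) : F x b d = -F x d b := hF _ _
  have e' (d) : F x c d = -F x d c := hF _ _
  have e'' (d) : F x a d = -F x d a := hF _ _
  simp only [covDeriv2, hs _ b a, hs _ c a, hs _ c b, e, e', e'', mul_neg, Finset.sum_neg_distrib]
  ring

theorem pdMaxwell_closed (h : PDRegularAt P P₁ P₂ Q Q₁ Q₂ x) (α β : ℝ) (a b c : Fin 4) :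
    covDeriv2 (plebanskiDemianski P Q) (pdMaxwell α β) a b c x
      + covDeriv2 (plebanskiDemianski P Q) (pdMaxwell α β) b c a x
      + covDeriv2 (plebanskiDemianski P Q) (pdMaxwell α β) c a b x = 0 := by
  have h1 := one_add_mul_ne_zero h.W_ne
  have h2 := one_sub_mul_ne_zero h.W_ne
  have h3 : 1 + x 3 * x 2 ≠ 0 := by rwa [mul_comm]
  have h4 : 1 - x 3 * x 2 ≠ 0 := by rwa [mul_comm]
  rw [h.covDeriv2_cyclic fun a b => pdMaxwell_skew α β x a b]
  simp only [(grad_pdMaxwell α β h.W_ne _ _).pderiv_eq]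
  fin_cases a <;> fin_cases b <;> fin_cases c <;> simp <;> field_simp <;> ring

/-- Conceptually, the two parts are eigenforms of the Hodge star, so closedness of each gives
coclosedness; here the divergence is computed from the explicit Christoffel symbols. -/
theorem pdMaxwell_coclosed (h : PDRegularAt P P₁ P₂ Q Q₁ Q₂ x) (α β : ℝ) (b : Fin 4) :
    ∑ a, ∑ c, (plebanskiDemianski P Q x)⁻¹ a c *
      covDeriv2 (plebanskiDemianski P Q) (pdMaxwell α β) c a b x = 0 := by
  have h1 := one_add_mul_ne_zero h.W_ne
  have h2 := one_sub_mul_ne_zero h.W_ne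
  have hd := h.sub_ne
  have hP := h.P_ne
  have hQ := h.Q_ne
  -- Factoring 1 - p²q² puts the metric and the field over the same denominators 1 ± pq.
  have hw : pdW x = (1 + x 2 * x 3)⁻¹ * (1 - x 2 * x 3)⁻¹ := by
    rw [pdW, ← mul_inv]; ring
  simp only [h.inv_eq, covDeriv2, (grad_pdMaxwell α β h.W_ne _ _).pderiv_eq, h.christoffel_eq,
    Fin.sum_univ_four]
  fin_cases b <;> simp [pdInverse, pdChristoffel, pdMaxwell, hw, pdU] <;> field_simp <;> ring

end PDRegularAt
end

theorem PDRegularAt.maxwellNormSq_eq {P P₁ P₂ Q Q₁ Q₂ : ℝ → ℝ} {x : Fin 4 → ℝ}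
    (h : PDRegularAt P P₁ P₂ Q Q₁ Q₂ x) (α β : ℝ) :
    maxwellNormSq (plebanskiDemianski P Q) (pdMaxwell α β) x =
      2 * ((x 2 - x 3) ^ 4 * (α * (1 + x 2 * x 3)⁻¹ ^ 2 + β * (1 - x 2 * x 3)⁻¹ ^ 2) ^ 2 +
        (x 2 - x 3) ^ 4 * (α * (1 + x 2 * x 3)⁻¹ ^ 2 - β * (1 - x 2 * x 3)⁻¹ ^ 2) ^ 2) := by
  simp only [maxwellNormSq, h.maxwellSquare_eq]
  exact h.contract_pdDiagonal _ _

/-! ### The trace equation R = 4λ and its solutions -/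

/-- The trace of the Einstein-Maxwell equations: the Maxwell stress tensor is trace-free. -/
theorem PDRegularAt.scalarCurv_of_einsteinMaxwell {P P₁ P₂ Q Q₁ Q₂ : ℝ → ℝ} {x : Fin 4 → ℝ}
    (h : PDRegularAt P P₁ P₂ Q Q₁ Q₂ x) {F : Tensor2} {lam : ℝ}
    (hE : ∀ a b, ricciTensor (plebanskiDemianski P Q) a b x
        - scalarCurv (plebanskiDemianski P Q) x / 2 * plebanskiDemianski P Q x a b
        + lam * plebanskiDemianski P Q x a b
      = 2 * maxwellSquare (plebanskiDemianski P Q) F a b x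
        - (1 / 2) * plebanskiDemianski P Q x a b * maxwellNormSq (plebanskiDemianski P Q) F x) :
    scalarCurv (plebanskiDemianski P Q) x = 4 * lam := by
  -- Both eigenvalues equal to 1 give the metric itself, so this says g^{ab}g_{ab} = 4, which is
  -- what makes the Maxwell side trace-free.
  have hg := h.contract_pdDiagonal 1 1
  rw [pdDiagonal_one_one] at hg
  set g := plebanskiDemianski P Q
  have hsum := Finset.sum_congr rfl fun a (_ : a ∈ Finset.univ) =>
    Finset.sum_congr rfl fun b (_ : b ∈ Finset.univ) => congrArg ((g x)⁻¹ a b * ·) (hE a b)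
  have hl : ∑ a, ∑ b, (g x)⁻¹ a b * (ricciTensor g a b x - scalarCurv g x / 2 * g x a b
      + lam * g x a b) = scalarCurv g x
        + (lam - scalarCurv g x / 2) * ∑ a, ∑ b, (g x)⁻¹ a b * g x a b := by
    conv_rhs => enter [1]; rw [scalarCurv]
    simp only [Finset.mul_sum, ← Finset.sum_add_distrib]
    exact Finset.sum_congr rfl fun a _ => Finset.sum_congr rfl fun b _ => by ring
  have hr : ∑ a, ∑ b, (g x)⁻¹ a b * (2 * maxwellSquare g F a b x
      - (1 / 2) * g x a b * maxwellNormSq g F x) = 2 * maxwellNormSq g F x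
        - 1 / 2 * maxwellNormSq g F x * ∑ a, ∑ b, (g x)⁻¹ a b * g x a b := by
    conv_rhs => enter [1]; rw [maxwellNormSq]
    simp only [Finset.mul_sum, ← Finset.sum_sub_distrib]
    exact Finset.sum_congr rfl fun a _ => Finset.sum_congr rfl fun b _ => by ring
  have := hl.symm.trans (hsum.trans hr)
  rw [hg] at this
  linarith

/-- A partial derivative in the coordinate `x 2` of an identity holding on an open set. -/
theorem eq_zero_of_hasDerivAt_of_forall_mem {U : Set (Fin 4 → ℝ)} (hU : IsOpen U)
    {G G' : ℝ → ℝ → ℝ} (hG : ∀ x ∈ U, G (x 2) (x 3) = 0)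
    (hd : ∀ x ∈ U, HasDerivAt (fun p => G p (x 3)) (G' (x 2) (x 3)) (x 2)) :
    ∀ x ∈ U, G' (x 2) (x 3) = 0 := by
  intro x hx
  have hc : Continuous fun p : ℝ => Function.update x 2 p := continuous_const.update 2 continuous_id
  have hev : ∀ᶠ p in nhds (x 2), Function.update x 2 p ∈ U := by
    refine hc.continuousAt.eventually_mem ?_
    rw [Function.update_eq_self]
    exact hU.mem_nhds hx
  have he : (fun p => G p (x 3)) =ᶠ[nhds (x 2)] fun _ => 0 := by
    filter_upwards [hev] with p hp
    simpa using hG _ hp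
  exact (hd x hx).unique ((hasDerivAt_const (x 2) (0 : ℝ)).congr_of_eventuallyEq he)

/-- Two functions with the same derivative on an open interval differ by a constant. -/
theorem exists_eq_add_const_of_hasDerivAt {I : Set ℝ} (hI : IsOpen I) (hI' : IsPreconnected I)
    {f g f' : ℝ → ℝ} (hf : ∀ t ∈ I, HasDerivAt f (f' t) t) (hg : ∀ t ∈ I, HasDerivAt g (f' t) t) :
    ∃ c, ∀ t ∈ I, f t = g t + c := by
  have hd (t) (ht : t ∈ I) : HasDerivAt (fun s => f s - g s) 0 t := by
    simpa using (hf t ht).fun_sub (hg t ht)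
  obtain ⟨c, hc⟩ := hI.exists_is_const_of_deriv_eq_zero hI'
    (fun t ht => (hd t ht).differentiableAt.differentiableWithinAt) (fun t ht => (hd t ht).deriv)
  exact ⟨c, fun t ht => by linarith [hc t ht]⟩

/-- A function on an open interval whose fifth derivative vanishes is a quartic polynomial. -/
theorem exists_quartic_of_hasDerivAt {I : Set ℝ} (hI : IsOpen I) (hI' : IsPreconnected I)
    {f f₁ f₂ f₃ f₄ : ℝ → ℝ} (h : ∀ t ∈ I, HasDerivAt f (f₁ t) t)
    (h₁ : ∀ t ∈ I, HasDerivAt f₁ (f₂ t) t) (h₂ : ∀ t ∈ I, HasDerivAt f₂ (f₃ t) t)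
    (h₃ : ∀ t ∈ I, HasDerivAt f₃ (f₄ t) t) (h₄ : ∀ t ∈ I, HasDerivAt f₄ 0 t) :
    ∃ a₀ a₁ a₂ a₃ a₄ : ℝ, ∀ t ∈ I,
      f t = a₀ + a₁ * t + a₂ * t ^ 2 + a₃ * t ^ 3 + a₄ * t ^ 4 ∧
      f₁ t = a₁ + 2 * a₂ * t + 3 * a₃ * t ^ 2 + 4 * a₄ * t ^ 3 ∧
      f₂ t = 2 * a₂ + 6 * a₃ * t + 12 * a₄ * t ^ 2 ∧
      f₃ t = 6 * a₃ + 24 * a₄ * t ∧ f₄ t = 24 * a₄ := by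
  have hm (k : ℝ) (n : ℕ) (t : ℝ) : HasDerivAt (fun s : ℝ => k * s ^ n) (k * (n * t ^ (n - 1))) t :=
    (hasDerivAt_pow n t).const_mul k
  -- Integration from the top derivative down, with one new constant at each stage.
  obtain ⟨c₄, e₄⟩ := exists_eq_add_const_of_hasDerivAt hI hI' h₄ fun t _ => hasDerivAt_const t 0
  obtain ⟨c₃, e₃⟩ := exists_eq_add_const_of_hasDerivAt (g := fun t => c₄ * t ^ 1) hI hI' h₃
    fun t ht => (hm c₄ 1 t).congr_deriv (by rw [e₄ t ht]; simp)
  obtain ⟨c₂, e₂⟩ := exists_eq_add_const_of_hasDerivAt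
    (g := fun t => c₄ / 2 * t ^ 2 + c₃ * t ^ 1) hI hI' h₂
    fun t ht => ((hm (c₄ / 2) 2 t).add (hm c₃ 1 t)).congr_deriv (by rw [e₃ t ht]; simp; ring)
  obtain ⟨c₁, e₁⟩ := exists_eq_add_const_of_hasDerivAt
    (g := fun t => c₄ / 6 * t ^ 3 + c₃ / 2 * t ^ 2 + c₂ * t ^ 1) hI hI' h₁
    fun t ht => (((hm (c₄ / 6) 3 t).add (hm (c₃ / 2) 2 t)).add (hm c₂ 1 t)).congr_deriv
      (by rw [e₂ t ht]; simp; ring)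
  obtain ⟨c₀, e₀⟩ := exists_eq_add_const_of_hasDerivAt
    (g := fun t => c₄ / 24 * t ^ 4 + c₃ / 6 * t ^ 3 + c₂ / 2 * t ^ 2 + c₁ * t ^ 1) hI hI' h
    fun t ht => ((((hm (c₄ / 24) 4 t).add (hm (c₃ / 6) 3 t)).add (hm (c₂ / 2) 2 t)).add
      (hm c₁ 1 t)).congr_deriv (by rw [e₁ t ht]; simp; ring)
  refine ⟨c₀, c₁, c₂ / 2, c₃ / 6, c₄ / 24, fun t ht => ⟨?_, ?_, ?_, ?_, ?_⟩⟩
  · rw [e₀ t ht]; ring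
  · rw [e₁ t ht]; ring
  · rw [e₂ t ht]; ring
  · rw [e₃ t ht]; ring
  · rw [e₄ t ht]; ring

/-- Smooth solutions of the equation `R = 4 lam` for the Plebański-Demiański metric. -/
theorem exists_quartic_of_scalarCurv_equation {U : Set (Fin 4 → ℝ)} (hU : IsOpen U)
    (hI : IsPreconnected ((fun x : Fin 4 → ℝ => x 2) '' U)) {lam : ℝ}
    {P P₁ P₂ P₃ P₄ P₅ Q Q₁ Q₂ : ℝ → ℝ} (hpq : ∀ x ∈ U, x 2 ≠ x 3)
    (h : ∀ x ∈ U, HasDerivAt P (P₁ (x 2)) (x 2)) (h₁ : ∀ x ∈ U, HasDerivAt P₁ (P₂ (x 2)) (x 2))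
    (h₂ : ∀ x ∈ U, HasDerivAt P₂ (P₃ (x 2)) (x 2)) (h₃ : ∀ x ∈ U, HasDerivAt P₃ (P₄ (x 2)) (x 2))
    (h₄ : ∀ x ∈ U, HasDerivAt P₄ (P₅ (x 2)) (x 2))
    (hR : ∀ x ∈ U, (x 2 - x 3) ^ 2 * (Q₂ (x 3) - P₂ (x 2))
      + 6 * (x 2 - x 3) * (P₁ (x 2) + Q₁ (x 3)) - 12 * (P (x 2) - Q (x 3))
      - 4 * lam * (1 - x 2 ^ 2 * x 3 ^ 2) = 0) :
    ∃ a₀ a₁ a₂ a₃ a₄ : ℝ, ∀ x ∈ U,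
      P (x 2) = a₀ + a₁ * x 2 + a₂ * x 2 ^ 2 + a₃ * x 2 ^ 3 + a₄ * x 2 ^ 4 ∧
      Q (x 3) = (a₀ + lam / 3) + a₁ * x 3 + a₂ * x 3 ^ 2 + a₃ * x 3 ^ 3
        + (a₄ - lam / 3) * x 3 ^ 4 := by
  have hs (p q : ℝ) : HasDerivAt (fun p : ℝ => p - q) 1 p := (hasDerivAt_id p).sub_const q
  have hs2 (p q : ℝ) : HasDerivAt (fun p : ℝ => (p - q) ^ 2) (2 * (p - q)) p := by
    simpa using (hs p q).fun_pow 2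
  have hR₁ := eq_zero_of_hasDerivAt_of_forall_mem hU
    (G := fun p q => (p - q) ^ 2 * (Q₂ q - P₂ p) + 6 * (p - q) * (P₁ p + Q₁ q)
      - 12 * (P p - Q q) - 4 * lam * (1 - p ^ 2 * q ^ 2))
    (G' := fun p q => (p - q) * (2 * Q₂ q + 4 * P₂ p) - (p - q) ^ 2 * P₃ p + 6 * (Q₁ q - P₁ p)
      + 8 * lam * p * q ^ 2) hR fun x hx =>
    ((((hs2 _ _).fun_mul ((h₂ x hx).const_sub _)).fun_add
      (((hs _ _).const_mul 6).fun_mul ((h₁ x hx).add_const _))).fun_sub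
      (((h x hx).sub_const _).const_mul 12)).fun_sub
      ((((hasDerivAt_pow 2 (x 2)).mul_const _).const_sub 1).const_mul (4 * lam))
      |>.congr_deriv (by push_cast; ring)
  have hR₂ := eq_zero_of_hasDerivAt_of_forall_mem hU
    (G := fun p q => (p - q) * (2 * Q₂ q + 4 * P₂ p) - (p - q) ^ 2 * P₃ p + 6 * (Q₁ q - P₁ p)
      + 8 * lam * p * q ^ 2)
    (G' := fun p q => 2 * Q₂ q - 2 * P₂ p + 2 * (p - q) * P₃ p - (p - q) ^ 2 * P₄ p
      + 8 * lam * q ^ 2) hR₁ fun x hx => ((((hs _ _).fun_mul (((h₂ x hx).const_mul 4).const_add _)).fun_sub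
      ((hs2 _ _).fun_mul (h₃ x hx))).fun_add (((h₁ x hx).const_sub _).const_mul 6)).fun_add
      (((hasDerivAt_id (x 2)).const_mul (8 * lam)).mul_const _)
      |>.congr_deriv (by ring)
  have hR₃ := eq_zero_of_hasDerivAt_of_forall_mem hU
    (G := fun p q => 2 * Q₂ q - 2 * P₂ p + 2 * (p - q) * P₃ p - (p - q) ^ 2 * P₄ p
      + 8 * lam * q ^ 2)
    (G' := fun p q => -((p - q) ^ 2 * P₅ p)) hR₂ fun x hx => (((((h₂ x hx).const_mul 2).const_sub _).fun_add
      (((hs _ _).const_mul 2).fun_mul (h₃ x hx))).fun_sub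
      ((hs2 _ _).fun_mul (h₄ x hx))).add_const _
      |>.congr_deriv (by ring)
  have h₅ (x) (hx : x ∈ U) : P₅ (x 2) = 0 := by
    simpa [sub_ne_zero.mpr (hpq x hx)] using hR₃ x hx
  -- Connectedness is needed for the `p`-projection only: a single quartic must serve for all of P,
  -- and Q is then found pointwise.
  obtain ⟨a₀, a₁, a₂, a₃, a₄, ha⟩ := exists_quartic_of_hasDerivAt
    (isOpenMap_eval (2 : Fin 4) U hU) hI
    (Set.forall_mem_image.2 h) (Set.forall_mem_image.2 h₁) (Set.forall_mem_image.2 h₂)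
    (Set.forall_mem_image.2 h₃) (Set.forall_mem_image.2 fun x hx => by
      simpa only [h₅ x hx] using h₄ x hx)
  refine ⟨a₀, a₁, a₂, a₃, a₄, fun x hx => ?_⟩
  obtain ⟨e, e₁, e₂, e₃, e₄⟩ := ha _ (Set.mem_image_of_mem _ hx)
  have k := hR x hx
  have k₁ := hR₁ x hx
  have k₂ := hR₂ x hx
  simp only [e, e₁, e₂, e₃, e₄] at k k₁ k₂
  refine ⟨e, ?_⟩
  -- Second-order Taylor expansion in `p`, evaluated at p = q; it is exact because the third
  -- derivative vanishes. The terms in Q' and Q'' cancel and 12 Q(q) remains.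
  linear_combination (k - (x 2 - x 3) * k₁ + (x 2 - x 3) ^ 2 / 2 * k₂) / 12

theorem hasDerivAt_quartic (a₀ a₁ a₂ a₃ a₄ t : ℝ) :
    HasDerivAt (fun t => a₀ + a₁ * t + a₂ * t ^ 2 + a₃ * t ^ 3 + a₄ * t ^ 4)
      (a₁ + 2 * a₂ * t + 3 * a₃ * t ^ 2 + 4 * a₄ * t ^ 3) t := by
  have hm (k : ℝ) (n : ℕ) : HasDerivAt (fun s : ℝ => k * s ^ n) (k * (n * t ^ (n - 1))) t :=
    (hasDerivAt_pow n t).const_mul k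
  exact ((((((hasDerivAt_id t).const_mul a₁).const_add a₀).fun_add (hm a₂ 2)).fun_add
    (hm a₃ 3)).fun_add (hm a₄ 4)).congr_deriv (by push_cast; ring)

/-! ### Quartic structure functions give solutions -/

/-- For quartic structure functions the metric solves the Einstein-Maxwell equations. -/
theorem solvesEinsteinMaxwell_of_quartic {U : Set (Fin 4 → ℝ)} (hU : IsOpen U)
    {P Q : ℝ → ℝ} {lam a₀ a₁ a₂ a₃ a₄ : ℝ} (hP : ∀ x ∈ U, P (x 2) ≠ 0)
    (hQ : ∀ x ∈ U, Q (x 3) ≠ 0) (hpq : ∀ x ∈ U, x 2 ≠ x 3)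
    (hW : ∀ x ∈ U, 1 - x 2 ^ 2 * x 3 ^ 2 ≠ 0)
    (hPQ : ∀ x ∈ U, P (x 2) = a₀ + a₁ * x 2 + a₂ * x 2 ^ 2 + a₃ * x 2 ^ 3 + a₄ * x 2 ^ 4 ∧
      Q (x 3) = (a₀ + lam / 3) + a₁ * x 3 + a₂ * x 3 ^ 2 + a₃ * x 3 ^ 3
        + (a₄ - lam / 3) * x 3 ^ 4) :
    SolvesEinsteinMaxwell (plebanskiDemianski P Q) (pdMaxwell 1 ((a₄ - a₀ - lam / 3) / 4))
      lam U := by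
  -- P and Q are known only on the projections of `U`. These are open, so agreement there passes to
  -- germs and hence to derivatives.
  have hev (i : Fin 4) {f g : ℝ → ℝ} (hfg : ∀ x ∈ U, f (x i) = g (x i)) (x) (hx : x ∈ U) :
      f =ᶠ[nhds (x i)] g := by
    filter_upwards [(isOpenMap_eval i U hU).mem_nhds (Set.mem_image_of_mem _ hx)]
    rintro _ ⟨y, hy, rfl⟩
    exact hfg y hy
  let D (a₁ a₂ a₃ a₄ t : ℝ) : ℝ := a₁ + 2 * a₂ * t + 3 * a₃ * t ^ 2 + 4 * a₄ * t ^ 3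
  let D₂ (a₂ a₃ a₄ t : ℝ) : ℝ := 2 * a₂ + 6 * a₃ * t + 12 * a₄ * t ^ 2
  have hD (a₁ a₂ a₃ a₄ t : ℝ) : HasDerivAt (D a₁ a₂ a₃ a₄) (D₂ a₂ a₃ a₄ t) t := by
    simpa using (hasDerivAt_quartic a₁ (2 * a₂) (3 * a₃) (4 * a₄) 0 t).congr_deriv
      (g' := D₂ a₂ a₃ a₄ t) (by simp only [D₂]; ring)
  have hreg (x) (hx : x ∈ U) : PDRegularAt P (D a₁ a₂ a₃ a₄) (D₂ a₂ a₃ a₄)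
      Q (D a₁ a₂ a₃ (a₄ - lam / 3)) (D₂ a₂ a₃ (a₄ - lam / 3)) x :=
    { hP := (hasDerivAt_quartic a₀ a₁ a₂ a₃ a₄ _).congr_of_eventuallyEq
        (hev 2 (fun x hx => (hPQ x hx).1) x hx)
      hP₁ := hD _ _ _ _ _
      hQ := (hasDerivAt_quartic (a₀ + lam / 3) a₁ a₂ a₃ (a₄ - lam / 3) _).congr_of_eventuallyEq
        (hev 3 (fun x hx => (hPQ x hx).2) x hx)
      hQ₁ := hD _ _ _ _ _
      P_ne := hP x hx
      Q_ne := hQ x hx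
      sub_ne := sub_ne_zero.mpr (hpq x hx)
      W_ne := hW x hx }
  refine ⟨fun x hx a b => ?_, fun x hx b => (hreg x hx).pdMaxwell_coclosed _ _ b,
    fun x hx a b c => by rw [(hreg x hx).pdMaxwell_closed, zero_div]⟩
  have h := hreg x hx
  have hn := Filter.eventually_of_mem (hU.mem_nhds hx) hreg
  have hw : pdW x = (1 + x 2 * x 3)⁻¹ * (1 - x 2 * x 3)⁻¹ := by
    rw [pdW, ← mul_inv]; ring
  have hW' := h.W_ne
  have hsum : pdRicciQ P (D a₁ a₂ a₃ a₄) Q (D a₁ a₂ a₃ (a₄ - lam / 3))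
      (D₂ a₂ a₃ (a₄ - lam / 3)) x + pdRicciP P (D a₁ a₂ a₃ a₄) (D₂ a₂ a₃ a₄) Q
      (D a₁ a₂ a₃ (a₄ - lam / 3)) x = 2 * lam := by
    simp only [pdRicciQ, pdRicciP, pdW, (hPQ x hx).1, (hPQ x hx).2, D, D₂]
    field_simp
    ring
  -- The factor 2(a₄ - a₀ - λ/3) is 8αβ for the chosen field, which is where its second coefficient
  -- comes from.
  have hdiff : pdRicciQ P (D a₁ a₂ a₃ a₄) Q (D a₁ a₂ a₃ (a₄ - lam / 3))
      (D₂ a₂ a₃ (a₄ - lam / 3)) x - pdRicciP P (D a₁ a₂ a₃ a₄) (D₂ a₂ a₃ a₄) Q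
      (D a₁ a₂ a₃ (a₄ - lam / 3)) x
        = 2 * (a₄ - a₀ - lam / 3) * (x 2 - x 3) ^ 4 * pdW x ^ 2 := by
    simp only [pdRicciQ, pdRicciP, (hPQ x hx).1, (hPQ x hx).2, D, D₂]
    ring
  rw [PDRegularAt.ricciTensor_eq hn, PDRegularAt.scalarCurv_eq hn, h.maxwellSquare_eq,
    h.maxwellNormSq_eq, ← pdDiagonal_one_one, pdDiagonal_apply _ _ a b, pdDiagonal_apply 1 1 a b,
    pdDiagonal_apply (_ * _ ^ 2) _ a b]
  rw [hw] at hdiff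
  generalize pdRicciQ _ _ _ _ _ _ = ρ at *
  generalize pdRicciP _ _ _ _ _ _ = σ at *
  generalize (1 + x 2 * x 3)⁻¹ = e at *
  generalize (1 - x 2 * x 3)⁻¹ = f at *
  generalize pdDiagonal P Q 1 0 x a b = A
  generalize pdDiagonal P Q 0 1 x a b = B
  -- The trace part enters equally on both planes, the trace-free part with opposite signs.
  linear_combination (-(A + B) / 2) * hsum + (A - B) / 2 * hdiff

/-- A smooth function on an open set is smooth after differentiation, and has its derivative. -/
theorem ContDiffOn.smooth_deriv_of_isOpen {f : ℝ → ℝ} {I : Set ℝ} (hf : ContDiffOn ℝ ∞ f I)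
    (hI : IsOpen I) : ContDiffOn ℝ ∞ (deriv f) I ∧ ∀ t ∈ I, HasDerivAt f (deriv f t) t :=
  ⟨hf.deriv_of_isOpen hI (by simp), fun _ ht =>
    ((hf.differentiableOn (by simp)).differentiableAt (hI.mem_nhds ht)).hasDerivAt⟩

end

/-! ### The equivalence -/

theorem mainTheorem5 (U : Set (Fin 4 → ℝ)) (hUo : IsOpen U) (hUc : IsConnected U)
    (P Q : ℝ → ℝ)
    (hPs : ContDiffOn ℝ ∞ P ((fun x : Fin 4 → ℝ => x 2) '' U))
    (hQs : ContDiffOn ℝ ∞ Q ((fun x : Fin 4 → ℝ => x 3) '' U))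
    (hP : ∀ x ∈ U, 0 < P (x 2)) (hQ : ∀ x ∈ U, Q (x 3) < 0)
    (hpq : ∀ x ∈ U, x 2 ≠ x 3) (hpq' : ∀ x ∈ U, 0 < 1 - x 2 ^ 2 * x 3 ^ 2)
    (lam : ℝ) :
    SatisfiesCosmologicalEinsteinMaxwell (plebanskiDemianski P Q) lam U ↔
      ∃ a₀ a₁ a₂ a₃ a₄ : ℝ, ∀ x ∈ U,
        P (x 2) = a₀ + a₁ * x 2 + a₂ * x 2 ^ 2 + a₃ * x 2 ^ 3 + a₄ * x 2 ^ 4 ∧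
        Q (x 3) = (a₀ + lam / 3) + a₁ * x 3 + a₂ * x 3 ^ 2 + a₃ * x 3 ^ 3
          + (a₄ - lam / 3) * x 3 ^ 4 := by
  constructor
  -- The Maxwell equations and the smoothness of `F` are dropped: the trace of the Einstein equation
  -- suffices.
  · rintro ⟨F, -, hE, -⟩
    have hI : IsOpen ((fun x : Fin 4 → ℝ => x 2) '' U) := isOpenMap_eval (2 : Fin 4) U hUo
    have hJ : IsOpen ((fun x : Fin 4 → ℝ => x 3) '' U) := isOpenMap_eval (3 : Fin 4) U hUo
    obtain ⟨s₁, d⟩ := hPs.smooth_deriv_of_isOpen hI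
    obtain ⟨s₂, d₁⟩ := s₁.smooth_deriv_of_isOpen hI
    obtain ⟨s₃, d₂⟩ := s₂.smooth_deriv_of_isOpen hI
    obtain ⟨s₄, d₃⟩ := s₃.smooth_deriv_of_isOpen hI
    obtain ⟨-, d₄⟩ := s₄.smooth_deriv_of_isOpen hI
    obtain ⟨t₁, k⟩ := hQs.smooth_deriv_of_isOpen hJ
    obtain ⟨-, k₁⟩ := t₁.smooth_deriv_of_isOpen hJ
    rw [Set.forall_mem_image] at d d₁ d₂ d₃ d₄ k k₁
    have hreg (x) (hx : x ∈ U) : PDRegularAt P (deriv P) (deriv (deriv P))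
        Q (deriv Q) (deriv (deriv Q)) x :=
      { hP := d hx
        hP₁ := d₁ hx
        hQ := k hx
        hQ₁ := k₁ hx
        P_ne := (hP x hx).ne'
        Q_ne := (hQ x hx).ne
        sub_ne := sub_ne_zero.mpr (hpq x hx)
        W_ne := (hpq' x hx).ne' }
    refine exists_quartic_of_scalarCurv_equation (Q₁ := deriv Q) (Q₂ := deriv (deriv Q)) hUo
      (hUc.isPreconnected.image _ (continuous_apply 2).continuousOn) hpq
      (fun _ hx => d hx) (fun _ hx => d₁ hx) (fun _ hx => d₂ hx) (fun _ hx => d₃ hx)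
      (fun _ hx => d₄ hx) fun x hx => ?_
    have hn := Filter.eventually_of_mem (hUo.mem_nhds hx) hreg
    have hR := (hreg x hx).scalarCurv_of_einsteinMaxwell (hE x hx)
    rw [PDRegularAt.scalarCurv_eq hn, pdRicciQ_add_pdRicciP (hreg x hx).W_ne] at hR
    -- Clearing 1 - p²q² gives the polynomial form of R = 4λ.
    rw [pdW, ← div_eq_mul_inv, div_eq_iff (hreg x hx).W_ne] at hR
    linear_combination hR
  · rintro ⟨a₀, a₁, a₂, a₃, a₄, hPQ⟩
    exact ⟨_, isSmoothTwoForm_pdMaxwell _ _ fun x hx => (hpq' x hx).ne',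
      solvesEinsteinMaxwell_of_quartic hUo (fun x hx => (hP x hx).ne') (fun x hx => (hQ x hx).ne)
        hpq (fun x hx => (hpq' x hx).ne') hPQ⟩
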